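/- **Setting.** Let $d\ge 1$, let $f:\mathbb{R}^d\to\mathbb{R}\cup\{\infty\}$ be proper, closed (lower semicontinuous) and $\ell$-weakly convex with $\ell>0$, i.e. $f+\frac{\ell}{2}\|\cdot\|^2$ is convex. Let $0<\lambda<\frac{1}{2\ell}$ and $$f_\lambda(x)=\min_y\Big\{f(y)+\tfrac1{2\lambda}\|y-x\|^2\Big\},\qquad \mathrm{prox}_{\lambda f}(x)=\operatorname*{argmin}_y\Big\{f(y)+\tfrac1{2\lambda}\|y-x\|^2\Big\}.$$ Assume $f_\lambda^\star:=\inf f_\lambda>-\infty$, let $x_0\in\mathbb{R}^d$ and $\Delta:=f_\lambda(x_0)-f_\lambda^\star$. Let $\rho>0$, $\epsilon\in(0,1/(\lambda^2\rho))$ and $\delta\in(0,1)$. For $\iota>0$ put $$\eta=\lambda,\quad r=\frac{\epsilon}{400\iota^3},\quad \mathscr{T}=\frac{\iota}{\lambda\sqrt{\rho\epsilon}},\quad \mathscr{F}=\frac{1}{50\iota^3}\sqrt{\frac{\epsilon^3}{\rho}},\quad \mathscr{S}=\frac1{4\iota}\sqrt{\frac{\epsilon}{\rho}},\quad T=4\max\Big\{\frac{\Delta}{\mathscr{F}/(2\mathscr{T})},\frac{\Delta}{\eta\epsilon^2/2}\Big\}.$$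 *Perturbed PPA:* start with $x_0$ and $t_{\rm perturb}=0$. In round $t=0,1,2,\dots$: if $\|\nabla f_\lambda(x_t)\|\le\epsilon$ and $t-t_{\rm perturb}>\mathscr{T}$, put $x_t^+=x_t-\eta\xi_t$ and $t_{\rm perturb}=t$; otherwise put $x_t^+=x_t$. Then set $x_{t+1}=\mathrm{prox}_{\eta f}(x_t^+)$. The $\xi_t$ are independent and uniformly distributed on the closed ball of radius $r$ around $0$. *Hessian assumption (with parameter $\iota$):* around the (approximate) critical points $f_\lambda$ has a $\rho$-Lipschitz Hessian; precisely, for every $x$ with $\|\nabla f_\lambda(x)\|\le\epsilon$, the function $f_\lambda$ is twice differentiable on the open ball $B(x,\mathscr{S})$ and $\|\nabla^2f_\lambda(y)-\nabla^2f_\lambda(z)\|\le\rho\|y-z\|$ for all $y,z\in B(x,\mathscr{S})$. **Theorem.** There is an absolute constant $c_0>0$ such that the following holds. 1. In the setting above, let $$\iota\ge c_0\max\Big\{1,\log\frac{d\,\Delta}{\lambda\epsilon^2\delta}\Big\}$$ (where the maximum is read as $1$ if $\Delta=0$), and let the Hessian assumption hold. Then $f_\lambda$ is differentiable and $\mathrm{prox}_{\lambda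 f}(x)=x-\lambda\nabla f_\lambda(x)$ for all $x$, so that perturbed PPA is perturbed gradient descent on $f_\lambda$ with step size $\lambda$; and with probability at least $1-\delta$, at least half of the indices $t\in\{0,\dots,\lceil T\rceil-1\}$ are such that $f_\lambda$ is twice differentiable and $$\|\nabla f_\lambda(x)\|\le\epsilon,\qquad \lambda_{\min}(\nabla^2f_\lambda(x))>-\sqrt{\rho\epsilon}$$ at both $x=x_t$ and $x=x_t^+$. At these points $\mathrm{prox}_{\lambda f}$ is moreover differentiable with $\lambda_{\max}(\nabla\,\mathrm{prox}_{\lambda f}(x))<1+\lambda\sqrt{\rho\epsilon}$, i.e. $x$ is an $\epsilon$-approximate local minimum. 2. For every $c\ge c_0$ there is a constant $K$, depending only on $c$, such that with $\iota=c\max\{1,\log\frac{d\Delta}{\lambda\epsilon^2\delta}\}$, for all $d\ge2$, all $\lambda,\rho,\epsilon,\delta>0$ and all $\Delta\ge0$, $$T\le K\,\frac{\Delta}{\lambda\epsilon^2}\,(\log d)^4\Big(1+\log^+\frac{\Delta}{\lambda\epsilon^2\delta}\Big)^4,\qquad \log^+u=\max\{0,\log u\}\ \ (\log^+0=0);$$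 that is, $T=O\big(\frac{f_\lambda(x_0)-f_\lambda^\star}{\lambda\epsilon^2}(\log d)^4\big)$ up to logarithmic factors in the other parameters. -/

import Mathlib

noncomputable section

namespace PerturbedProx

open MeasureTheory

/-- The Euclidean space `ℝ^d`. -/
abbrev Eu (d : ℕ) : Type := EuclideanSpace ℝ (Fin d)

/-- `f : ℝ^d → ℝ ∪ {∞}` is proper and closed (lower semicontinuous). -/
structure ClosedProper {d : ℕ} (f : Eu d → EReal) : Prop where
  ne_bot : ∀ x, f x ≠ ⊥
  proper : ∃ x, f x ≠ ⊤
  lsc : LowerSemicontinuous f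

/-- `f` is `ell`-weakly convex: `f + (ell / 2) ‖·‖²` is convex, i.e. has a convex epigraph. -/
def WeaklyConvex {d : ℕ} (f : Eu d → EReal) (ell : ℝ) : Prop :=
  Convex ℝ {p : Eu d × ℝ | f p.1 + ((ell / 2 * ‖p.1‖ ^ 2 : ℝ) : EReal) ≤ (p.2 : EReal)}

/-- The function `y ↦ f y + ‖y - x‖² / (2 lam)`. -/
def proxObjective {d : ℕ} (f : Eu d → EReal) (lam : ℝ) (x y : Eu d) : EReal :=
  f y + ((1 / (2 * lam) * ‖y - x‖ ^ 2 : ℝ) : EReal)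

/-- The Moreau envelope `f_lam`. -/
def moreau {d : ℕ} (f : Eu d → EReal) (lam : ℝ) (x : Eu d) : ℝ :=
  (⨅ y, proxObjective f lam x y).toReal

/-- The proximal map: a minimizer of `proxObjective f lam x` (unique in the setting of interest). -/
def prox {d : ℕ} (f : Eu d → EReal) (lam : ℝ) (x : Eu d) : Eu d :=
  Classical.epsilon fun p => ∀ y, proxObjective f lam x p ≤ proxObjective f lam x y

/-- The Hessian, as the derivative of the gradient. -/
def hessian {d : ℕ} (F : Eu d → ℝ) (x : Eu d) : Eu d →L[ℝ] Eu d :=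
  fderiv ℝ (gradient F) x

/-- `F` is twice differentiable at `x`. -/
def TwiceDifferentiableAt {d : ℕ} (F : Eu d → ℝ) (x : Eu d) : Prop :=
  (∀ᶠ y in nhds x, DifferentiableAt ℝ F y) ∧ DifferentiableAt ℝ (gradient F) x

/-- The smallest real eigenvalue (used for self-adjoint maps). -/
def lambdaMin {d : ℕ} (A : Eu d →L[ℝ] Eu d) : ℝ :=
  sInf {μ : ℝ | Module.End.HasEigenvalue (A : Eu d →ₗ[ℝ] Eu d) μ}

/-- The largest real eigenvalue (used for self-adjoint maps). -/
def lambdaMax {d : ℕ} (A : Eu d →L[ℝ] Eu d) : ℝ :=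
  sSup {μ : ℝ | Module.End.HasEigenvalue (A : Eu d →ₗ[ℝ] Eu d) μ}

/-- `x` is an `ε`-second-order stationary point of `F`. -/
def IsSecondOrderStationary {d : ℕ} (F : Eu d → ℝ) (ρ ε : ℝ) (x : Eu d) : Prop :=
  TwiceDifferentiableAt F x ∧ ‖gradient F x‖ ≤ ε ∧ -√(ρ * ε) < lambdaMin (hessian F x)

/-- `x` is an `ε`-approximate local minimum for the envelope `F` and the update map `S`
with step size `η`. -/
def IsApproxLocalMin {d : ℕ} (F : Eu d → ℝ) (S : Eu d → Eu d) (η ρ ε : ℝ) (x : Eu d) : Prop :=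
  ‖gradient F x‖ ≤ ε ∧ DifferentiableAt ℝ S x ∧ lambdaMax (fderiv ℝ S x) < 1 + η * √(ρ * ε)

/-- Around every point with gradient of norm at most `ε` (in particular around every critical
point), on the ball of radius `s`, `F` is twice differentiable with `ρ`-Lipschitz Hessian. -/
def HessianLipschitzNearCritical {d : ℕ} (F : Eu d → ℝ) (ρ ε s : ℝ) : Prop :=
  ∀ x, ‖gradient F x‖ ≤ ε →
    (∀ y ∈ Metric.ball x s, TwiceDifferentiableAt F y) ∧
    ∀ y ∈ Metric.ball x s, ∀ z ∈ Metric.ball x s, ‖hessian F y - hessian F z‖ ≤ ρ * ‖y - z‖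

/-! The parameters. -/

/-- The perturbation radius `r`. -/
def pertRadius (ε ι : ℝ) : ℝ := ε / (400 * ι ^ 3)

/-- The time interval between perturbations. -/
def pertInterval (lam ρ ε ι : ℝ) : ℝ := 1 / (lam * √(ρ * ε)) * ι

/-- The function decrease. -/
def decrease (ρ ε ι : ℝ) : ℝ := 1 / (50 * ι ^ 3) * √(ε ^ 3 / ρ)

/-- The localization radius. -/
def locRadius (ρ ε ι : ℝ) : ℝ := 1 / (4 * ι) * √(ε / ρ)

/-- The number `T` of iterations (a real number), where `Δ` is the initial optimality gap. -/
def numIter (lam ρ ε ι Δ : ℝ) : ℝ :=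
  4 * max (Δ / (decrease ρ ε ι / (2 * pertInterval lam ρ ε ι))) (Δ / (lam * ε ^ 2 / 2))

/-- The initial optimality gap `F x₀ - F*`. -/
def gap {d : ℕ} (F : Eu d → ℝ) (x₀ : Eu d) : ℝ := F x₀ - ⨅ x, F x

/-! The algorithm. Its state consists of the current iterate and of the last perturbation time. -/

open scoped Classical in
/-- The perturbation at time `t`: if `‖g x‖ ≤ ε` and `t - t_perturb > τ`, then `x` becomes
`x - η v` and `t_perturb` becomes `t`. -/
def perturb {d : ℕ} (g : Eu d → Eu d) (η τ ε : ℝ) (v : Eu d) (t : ℕ) (s : Eu d × ℕ) :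
    Eu d × ℕ :=
  if ‖g s.1‖ ≤ ε ∧ τ < (t : ℝ) - (s.2 : ℝ) then (s.1 - η • v, t) else s

/-- The state at the beginning of round `t`, for the noise sequence `ξ` and the update map `S`. -/
def state {d : ℕ} (S g : Eu d → Eu d) (η τ ε : ℝ) (x₀ : Eu d) (ξ : ℕ → Eu d) : ℕ → Eu d × ℕ
  | 0 => (x₀, 0)
  | t + 1 =>
    let s := perturb g η τ ε (ξ t) t (state S g η τ ε x₀ ξ t)
    (S s.1, s.2)

/-- The iterate `x_t` before the possible perturbation of round `t`. -/
def iterate {d : ℕ} (S g : Eu d → Eu d) (η τ ε : ℝ) (x₀ : Eu d) (ξ : ℕ → Eu d) (t : ℕ) : Eu d :=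
  (state S g η τ ε x₀ ξ t).1

/-- The iterate `x_t` after the possible perturbation of round `t`. -/
def iteratePost {d : ℕ} (S g : Eu d → Eu d) (η τ ε : ℝ) (x₀ : Eu d) (ξ : ℕ → Eu d) (t : ℕ) :
    Eu d :=
  (perturb g η τ ε (ξ t) t (state S g η τ ε x₀ ξ t)).1

/-- `x` satisfies the second-order condition for the envelope and is an `ε`-approximate local
minimum for the proximal map with step size `lam`. -/
def Good {d : ℕ} (f : Eu d → EReal) (lam ρ ε : ℝ) (x : Eu d) : Prop :=
  IsSecondOrderStationary (moreau f lam) ρ ε x ∧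
    IsApproxLocalMin (moreau f lam) (prox f lam) lam ρ ε x

/-- At least half of the first `N` iterates of the perturbed proximal point algorithm with step
size `η = lam` are good, both before and after the perturbation of their round. -/
def HalfGood {d : ℕ} (f : Eu d → EReal) (lam ρ ε ι : ℝ) (x₀ : Eu d) (ξ : ℕ → Eu d) (N : ℕ) :
    Prop :=
  (N : ℝ) / 2 ≤ (Set.ncard {t : ℕ | t < N ∧
    Good f lam ρ ε (iterate (prox f lam) (gradient (moreau f lam)) lam
      (pertInterval lam ρ ε ι) ε x₀ ξ t) ∧
    Good f lam ρ ε (iteratePost (prox f lam) (gradient (moreau f lam)) lam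
      (pertInterval lam ρ ε ι) ε x₀ ξ t)} : ℝ)

end PerturbedProx

end

noncomputable section
namespace PerturbedProx
open MeasureTheory

/-! ### The Moreau envelope of a weakly convex function -/

/-! Since `lam < 1 / (2 ell)`, the proximal objective is strongly convex with modulus `1 / lam - ell
> 1 / (2 lam)`. This makes the envelope `F` differentiable with `1 / lam`-Lipschitz gradient `(x -
prox x) / lam`. The algorithm is thus gradient descent whose step `lam` is the reciprocal of that
Lipschitz constant, and each step lowers `F` by at least `lam / 2 * ‖∇F‖²`.

Rounds with a large gradient therefore pay for themselves; the issue is to leave strict saddle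
points. A run that fails to lose half of `decrease` during a window stays within `locRadius` of its
saddle (`iterate_mem_ball`), where the Hessian is nearly constant. If the noises of two such runs
differed by `t • e`, with `e` a bottom unit eigenvector, the runs would separate by at least `exp (ι
/ 4) * lam * t / 2`. So noises that fail cannot differ by `t • e` once `t` exceeds a width
exponentially small in `ι` (`sub_ne_of_mem_stuck`). Packing disjoint translates bounds the volume of
such a set (`volume_thin_le`, `volume_stuck_le`); independence and a union bound over the rounds
then show that all perturbations at saddles succeed with probability at least `1 - δ`
(`prob_half_settled`).

Given this, the count is deterministic (`card_not_settled_le`): a potential that absorbs the effect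
of the noise can drop by at most `1.01 Δ`, and apart from the first window each bad round is charged
a drop `β`.

The logarithm in `ι` does not contain `ρ`, while the union bound involves `1 / (lam * √(ρ * ε))`.
This factor is controlled because a visited saddle forces `Δ ≥ decrease` (`exists_le_sub_decrease`).
-/

lemma WeaklyConvex.le_combo {d : ℕ} {f : Eu d → EReal} {ell : ℝ} (h : WeaklyConvex f ell)
    {a b : Eu d} {α β s : ℝ} (ha : f a ≤ (α : EReal)) (hb : f b ≤ (β : EReal))
    (hs0 : 0 ≤ s) (hs1 : s ≤ 1) :
    f ((1 - s) • a + s • b) ≤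
      (((1 - s) * α + s * β + ell / 2 * (s * (1 - s) * ‖a - b‖ ^ 2) : ℝ) : EReal) := by
  have key : ∀ (y : Eu d) (γ : ℝ), f y ≤ (γ : EReal) →
      (y, γ + ell / 2 * ‖y‖ ^ 2) ∈
        {p : Eu d × ℝ | f p.1 + ((ell / 2 * ‖p.1‖ ^ 2 : ℝ) : EReal) ≤ (p.2 : EReal)} := by
    intro y γ hy
    simp only [Set.mem_ofPred_eq]
    rw [EReal.coe_add]
    gcongr
  have hz := h (key a α ha) (key b β hb) (sub_nonneg.2 hs1) hs0 (by ring)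
  simp only [Set.mem_ofPred_eq, Prod.smul_mk, Prod.mk_add_mk, smul_eq_mul] at hz
  rw [← EReal.le_sub_iff_add_le (Or.inl (EReal.coe_ne_bot _)) (Or.inl (EReal.coe_ne_top _)),
    ← EReal.coe_sub] at hz
  refine hz.trans (EReal.coe_le_coe_iff.2 (le_of_eq ?_))
  rw [@norm_add_sq_real, @norm_sub_sq_real, norm_smul, norm_smul, real_inner_smul_left,
    real_inner_smul_right, Real.norm_of_nonneg hs0, Real.norm_of_nonneg (sub_nonneg.2 hs1)]
  ring

lemma proxObjective_le_iff {d : ℕ} {f : Eu d → EReal} {lam : ℝ} {x y : Eu d} {α : ℝ} :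
    proxObjective f lam x y ≤ (α : EReal) ↔
      f y ≤ ((α - 1 / (2 * lam) * ‖y - x‖ ^ 2 : ℝ) : EReal) := by
  unfold proxObjective
  rw [← EReal.le_sub_iff_add_le (Or.inl (EReal.coe_ne_bot _)) (Or.inl (EReal.coe_ne_top _)),
    ← EReal.coe_sub]

/-- The quadratic term contributes `1 / lam` to the modulus of convexity and weak convexity takes
away `ell`. Working with real upper bounds `α`, `β` avoids subtraction in `EReal`. -/
lemma proxObjective_le_combo {d : ℕ} {f : Eu d → EReal} {ell lam : ℝ} (h : WeaklyConvex f ell)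
    {x a b : Eu d} {α β s : ℝ} (ha : proxObjective f lam x a ≤ (α : EReal))
    (hb : proxObjective f lam x b ≤ (β : EReal)) (hs0 : 0 ≤ s) (hs1 : s ≤ 1) :
    proxObjective f lam x ((1 - s) • a + s • b) ≤
      (((1 - s) * α + s * β - (1 / lam - ell) / 2 * (s * (1 - s) * ‖a - b‖ ^ 2) : ℝ) : EReal) := by
  rw [proxObjective_le_iff] at *
  refine (h.le_combo ha hb hs0 hs1).trans (EReal.coe_le_coe_iff.2 (le_of_eq ?_))
  have e1 : (1 - s) • a + s • b - x = (1 - s) • (a - x) + s • (b - x) := by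
    module
  have e2 : a - b = (a - x) - (b - x) := by abel
  rw [e1, e2]
  generalize a - x = p
  generalize b - x = q
  rw [@norm_add_sq_real, @norm_sub_sq_real, norm_smul, norm_smul, real_inner_smul_left,
    real_inner_smul_right, Real.norm_of_nonneg hs0, Real.norm_of_nonneg (sub_nonneg.2 hs1)]
  field_simp
  ring

lemma lowerSemicontinuous_proxObjective {d : ℕ} {f : Eu d → EReal} (hf : LowerSemicontinuous f)
    (lam : ℝ) (x : Eu d) : LowerSemicontinuous (proxObjective f lam x) := by
  unfold proxObjective
  refine LowerSemicontinuous.add' hf ?_ ?_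
  · apply Continuous.lowerSemicontinuous
    exact continuous_coe_real_ereal.comp (by fun_prop)
  · intro y
    exact EReal.continuousAt_add (Or.inr (EReal.coe_ne_bot _)) (Or.inr (EReal.coe_ne_top _))

lemma proxObjective_ne_bot {d : ℕ} {f : Eu d → EReal} (hf : ClosedProper f) (lam : ℝ)
    (x y : Eu d) : proxObjective f lam x y ≠ ⊥ := by
  unfold proxObjective
  rw [Ne, EReal.add_eq_bot_iff, not_or]
  exact ⟨hf.ne_bot y, EReal.coe_ne_bot _⟩

/-- Strong convexity confines a sublevel set to a ball, and a lower semicontinuous function attains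
its minimum on a compact set. -/
lemma exists_proxObjective_min {d : ℕ} {f : Eu d → EReal} {ell lam : ℝ} (hf : ClosedProper f)
    (h : WeaklyConvex f ell) (hμ : 0 < 1 / lam - ell) (x : Eu d) :
    ∃ p, ∀ y, proxObjective f lam x p ≤ proxObjective f lam x y := by
  obtain ⟨x₁, hx₁⟩ := hf.proper
  set φ := proxObjective f lam x with hφ
  have hlsc : LowerSemicontinuous φ := lowerSemicontinuous_proxObjective hf.lsc lam x
  have hbot : ∀ y, φ y ≠ ⊥ := proxObjective_ne_bot hf lam x
  have htop : φ x₁ ≠ ⊤ := by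
    simp only [hφ, proxObjective]
    exact EReal.add_ne_top hx₁ (EReal.coe_ne_top _)
  obtain ⟨α, hα⟩ : ∃ α : ℝ, φ x₁ = (α : EReal) := ⟨_, (EReal.coe_toReal htop (hbot _)).symm⟩
  obtain ⟨z, hz, hzmin⟩ := (hlsc.lowerSemicontinuousOn _).exists_isMinOn
    (s := Metric.closedBall x₁ 1) ⟨x₁, by simp⟩ (isCompact_closedBall x₁ 1)
  have hzx : φ z ≤ φ x₁ := hzmin (by simp)
  obtain ⟨m, hm⟩ : ∃ m : ℝ, φ z = (m : EReal) :=
    ⟨_, (EReal.coe_toReal (ne_top_of_le_ne_top htop hzx) (hbot _)).symm⟩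
  set R := max 1 (1 + 2 * (α - m) / (1 / lam - ell)) with hR
  have hfar : ∀ y, φ y ≤ φ x₁ → y ∈ Metric.closedBall x₁ R := by
    intro y hy
    rw [Metric.mem_closedBall, dist_eq_norm]
    by_contra! hlt
    set ρ := ‖y - x₁‖ with hρ
    have hρ1 : 1 < ρ := lt_of_le_of_lt (le_max_left _ _) hlt
    have hρ2 : 1 + 2 * (α - m) / (1 / lam - ell) < ρ := lt_of_le_of_lt (le_max_right _ _) hlt
    -- The point of the segment at distance 1 from `x₁` lies in the unit ball, so its value is at
    -- least `m`; convexity bounds it by `α - (1 / lam - ell) / 2 * (ρ - 1)`, which is too small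
    -- when `ρ > R`.
    have hc := proxObjective_le_combo (s := ρ⁻¹) h (hα.le) (hα ▸ hy) (by positivity)
      (inv_le_one_of_one_le₀ hρ1.le)
    have hmem : (1 - ρ⁻¹) • x₁ + ρ⁻¹ • y ∈ Metric.closedBall x₁ 1 := by
      rw [Metric.mem_closedBall, dist_eq_norm]
      have : (1 - ρ⁻¹) • x₁ + ρ⁻¹ • y - x₁ = ρ⁻¹ • (y - x₁) := by module
      rw [this, norm_smul, Real.norm_of_nonneg (by positivity), ← hρ]
      exact (inv_mul_cancel₀ (by positivity)).le
    have hle := (hm ▸ hzmin hmem : (m : EReal) ≤ _).trans hc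
    rw [EReal.coe_le_coe_iff, norm_sub_rev, ← hρ] at hle
    have e : ρ⁻¹ * (1 - ρ⁻¹) * ρ ^ 2 = ρ - 1 := by field_simp
    rw [e] at hle
    have : 2 * (α - m) < (ρ - 1) * (1 / lam - ell) := by
      rw [← div_lt_iff₀ hμ]; linarith
    nlinarith
  obtain ⟨p, hp, hpmin⟩ := (hlsc.lowerSemicontinuousOn _).exists_isMinOn
    (s := Metric.closedBall x₁ R) ⟨x₁, hfar x₁ le_rfl⟩ (isCompact_closedBall x₁ R)
  refine ⟨p, fun y => ?_⟩
  rcases le_total (φ y) (φ x₁) with hy | hy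
  · exact hpmin (hfar y hy)
  · exact (hpmin (hfar x₁ le_rfl)).trans hy

lemma prox_spec {d : ℕ} {f : Eu d → EReal} {ell lam : ℝ} (hf : ClosedProper f)
    (h : WeaklyConvex f ell) (hμ : 0 < 1 / lam - ell) (x y : Eu d) :
    proxObjective f lam x (prox f lam x) ≤ proxObjective f lam x y :=
  Classical.epsilon_spec (exists_proxObjective_min hf h hμ x) y

lemma proxObjective_prox {d : ℕ} {f : Eu d → EReal} {ell lam : ℝ} (hf : ClosedProper f)
    (h : WeaklyConvex f ell) (hμ : 0 < 1 / lam - ell) (x : Eu d) :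
    proxObjective f lam x (prox f lam x) = (moreau f lam x : EReal) := by
  have hinf : ⨅ y, proxObjective f lam x y = proxObjective f lam x (prox f lam x) :=
    le_antisymm (iInf_le _ _) (le_iInf fun y => prox_spec hf h hμ x y)
  obtain ⟨x₁, hx₁⟩ := hf.proper
  have htop : proxObjective f lam x x₁ ≠ ⊤ := EReal.add_ne_top hx₁ (EReal.coe_ne_top _)
  unfold moreau
  rw [hinf, EReal.coe_toReal (ne_top_of_le_ne_top htop (prox_spec hf h hμ x x₁))
    (proxObjective_ne_bot hf _ _ _)]

lemma apply_prox {d : ℕ} {f : Eu d → EReal} {ell lam : ℝ} (hf : ClosedProper f)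
    (h : WeaklyConvex f ell) (hμ : 0 < 1 / lam - ell) (x : Eu d) :
    f (prox f lam x) ≤
      ((moreau f lam x - 1 / (2 * lam) * ‖prox f lam x - x‖ ^ 2 : ℝ) : EReal) :=
  proxObjective_le_iff.1 (proxObjective_prox hf h hμ x).le

/-- Quadratic growth of the proximal objective around the proximal point. -/
lemma moreau_add_le {d : ℕ} {f : Eu d → EReal} {ell lam : ℝ} (hf : ClosedProper f)
    (h : WeaklyConvex f ell) (hμ : 0 < 1 / lam - ell) {x y : Eu d} {β : ℝ}
    (hβ : proxObjective f lam x y ≤ (β : EReal)) :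
    moreau f lam x + (1 / lam - ell) / 2 * ‖prox f lam x - y‖ ^ 2 ≤ β := by
  set A := (1 / lam - ell) / 2 * ‖prox f lam x - y‖ ^ 2 with hA
  have hstep : ∀ s : ℝ, 0 < s → s ≤ 1 → moreau f lam x + (1 - s) * A ≤ β := by
    intro s hs0 hs1
    have h1 := proxObjective_le_combo h (proxObjective_prox hf h hμ x).le hβ hs0.le hs1
    have h2 := (proxObjective_prox hf h hμ x ▸ prox_spec hf h hμ x _ :
      (moreau f lam x : EReal) ≤ _).trans h1
    rw [EReal.coe_le_coe_iff] at h2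
    have : s * (moreau f lam x + (1 - s) * A) ≤ s * β := by rw [hA]; linarith
    exact le_of_mul_le_mul_left this hs0
  by_contra! hlt
  have hA0 : 0 ≤ A := by positivity
  have h1 := hstep 1 one_pos le_rfl
  have hApos : 0 < A := by linarith
  -- Instead of letting `s → 0`: this `s` gives away only half of the assumed excess `moreau f lam x
  -- + A - β`.
  set s := (moreau f lam x + A - β) / (2 * A) with hs
  have hsA : s * A = (moreau f lam x + A - β) / 2 := by rw [hs]; field_simp
  have := hstep s (by apply div_pos <;> linarith) (by rw [hs, div_le_one (by linarith)]; linarith)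
  nlinarith

lemma proxObjective_prox_le {d : ℕ} {f : Eu d → EReal} {ell lam : ℝ} (hf : ClosedProper f)
    (h : WeaklyConvex f ell) (hμ : 0 < 1 / lam - ell) (x y : Eu d) :
    proxObjective f lam y (prox f lam x) ≤ ((moreau f lam x +
      1 / (2 * lam) * (‖prox f lam x - y‖ ^ 2 - ‖prox f lam x - x‖ ^ 2) : ℝ) : EReal) := by
  rw [proxObjective_le_iff]
  refine (apply_prox hf h hμ x).trans (EReal.coe_le_coe_iff.2 (le_of_eq ?_))
  ring

/-- Adding the quadratic growth at both proximal points `p`, `q` and using `ell < 1 / (2 lam)` gives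
`‖p - q‖² ≤ 2 ⟪p - q, x - y⟫`, which is the claim squared. This is where `lam < 1 / (2 ell)` is
needed in full. -/
lemma norm_sub_prox_sub_le {d : ℕ} {f : Eu d → EReal} {ell lam : ℝ} (hf : ClosedProper f)
    (h : WeaklyConvex f ell) (hlam : 0 < lam) (hle : 2 * ell < 1 / lam) (hell : 0 < ell)
    (x y : Eu d) :
    ‖(x - prox f lam x) - (y - prox f lam y)‖ ≤ ‖x - y‖ := by
  have hμ : 0 < 1 / lam - ell := by linarith
  have h1 := moreau_add_le hf h hμ (proxObjective_prox_le hf h hμ x y)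
  have h2 := moreau_add_le hf h hμ (proxObjective_prox_le hf h hμ y x)
  set p := prox f lam x
  set q := prox f lam y
  rw [norm_sub_rev q p] at h1
  have h3 : (1 / lam - ell) * ‖p - q‖ ^ 2 ≤ 1 / (2 * lam) *
      ((‖p - y‖ ^ 2 - ‖p - x‖ ^ 2) + (‖q - x‖ ^ 2 - ‖q - y‖ ^ 2)) := by linarith
  have e1 : (‖p - y‖ ^ 2 - ‖p - x‖ ^ 2) + (‖q - x‖ ^ 2 - ‖q - y‖ ^ 2) =
      2 * inner ℝ (p - q) (x - y) := by
    simp only [@norm_sub_sq_real, inner_sub_left, inner_sub_right]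
    ring
  have h4 : 1 / (2 * lam) * ‖p - q‖ ^ 2 ≤ (1 / lam - ell) * ‖p - q‖ ^ 2 := by
    apply mul_le_mul_of_nonneg_right _ (sq_nonneg _)
    rw [one_div, mul_inv, ← one_div lam]
    norm_num
    rw [one_div] at hle
    linarith
  have h5 : ‖p - q‖ ^ 2 ≤ 2 * inner ℝ (p - q) (x - y) :=
    le_of_mul_le_mul_left (by rw [← e1]; linarith) (show 0 < 1 / (2 * lam) by positivity)
  rw [← sq_le_sq₀ (norm_nonneg _) (norm_nonneg _)]
  have e2 : (x - p) - (y - q) = (x - y) - (p - q) := by abel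
  rw [e2, @norm_sub_sq_real, real_inner_comm]
  linarith

/-- The proximal point of `x` is a competitor in the infimum that defines the envelope at `y`. -/
lemma moreau_le_quadratic {d : ℕ} {f : Eu d → EReal} {ell lam : ℝ} (hf : ClosedProper f)
    (h : WeaklyConvex f ell) (hlam : 0 < lam) (hμ : 0 < 1 / lam - ell) (x y : Eu d) :
    moreau f lam y ≤ moreau f lam x + inner ℝ (lam⁻¹ • (x - prox f lam x)) (y - x) +
      1 / (2 * lam) * ‖y - x‖ ^ 2 := by
  have h1 := moreau_add_le hf h hμ (proxObjective_prox_le hf h hμ x y)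
  have h2 : 0 ≤ (1 / lam - ell) / 2 * ‖prox f lam y - prox f lam x‖ ^ 2 := by positivity
  set p := prox f lam x
  have e : ‖p - y‖ ^ 2 - ‖p - x‖ ^ 2 = 2 * inner ℝ (x - p) (y - x) + ‖y - x‖ ^ 2 := by
    have : p - y = (p - x) - (y - x) := by abel
    rw [this, @norm_sub_sq_real, ← neg_sub p x, inner_neg_left]
    ring
  rw [e] at h1
  rw [real_inner_smul_left]
  have e2 : 1 / (2 * lam) * (2 * inner ℝ (x - p) (y - x) + ‖y - x‖ ^ 2) =
    lam⁻¹ * inner ℝ (x - p) (y - x) + 1 / (2 * lam) * ‖y - x‖ ^ 2 := by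
    field_simp
  linarith

/-- The quadratic upper bound with `x` and `y` exchanged becomes a lower bound once
`norm_sub_prox_sub_le` replaces the slope at `y` by the slope at `x`. -/
lemma hasGradientAt_moreau {d : ℕ} {f : Eu d → EReal} {ell lam : ℝ} (hf : ClosedProper f)
    (h : WeaklyConvex f ell) (hlam : 0 < lam) (hle : 2 * ell < 1 / lam) (hell : 0 < ell)
    (x : Eu d) : HasGradientAt (moreau f lam) (lam⁻¹ • (x - prox f lam x)) x := by
  have hμ : 0 < 1 / lam - ell := by linarith
  rw [hasGradientAt_iff_isLittleO]
  have hO : (fun y => moreau f lam y - moreau f lam x -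
      inner ℝ (lam⁻¹ • (x - prox f lam x)) (y - x)) =O[nhds x] fun y => ‖y - x‖ ^ 2 := by
    refine Asymptotics.IsBigO.of_bound (3 / (2 * lam)) (Filter.Eventually.of_forall fun y => ?_)
    have h1 := moreau_le_quadratic hf h hlam hμ x y
    have h2 := moreau_le_quadratic hf h hlam hμ y x
    have h3 := norm_sub_prox_sub_le hf h hlam hle hell x y
    set p := x - prox f lam x
    set q := y - prox f lam y
    have h4 : inner ℝ (lam⁻¹ • q) (x - y) = - inner ℝ (lam⁻¹ • p) (y - x) +
        lam⁻¹ * inner ℝ (p - q) (y - x) := by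
      rw [← neg_sub y x, inner_neg_right, real_inner_smul_left, real_inner_smul_left,
        inner_sub_left p q]
      ring
    have h5 : inner ℝ (p - q) (y - x) ≤ ‖y - x‖ ^ 2 := by
      refine (real_inner_le_norm _ _).trans ?_
      rw [norm_sub_rev x y] at h3
      nlinarith [norm_nonneg (y - x)]
    have h6 : lam⁻¹ * inner ℝ (p - q) (y - x) ≤ lam⁻¹ * ‖y - x‖ ^ 2 := by gcongr
    rw [norm_sub_rev x y] at h2
    have e1 : 3 / (2 * lam) * ‖y - x‖ ^ 2 = lam⁻¹ * ‖y - x‖ ^ 2 +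
      1 / (2 * lam) * ‖y - x‖ ^ 2 := by field_simp; ring
    have e2 : 0 ≤ lam⁻¹ * ‖y - x‖ ^ 2 := by positivity
    rw [norm_pow, norm_norm, e1, Real.norm_eq_abs, abs_le]
    constructor <;> linarith
  refine hO.trans_isLittleO ?_
  have := Asymptotics.isLittleO_pow_sub_sub x (one_lt_two)
  simpa using this

/-- A differentiable function whose gradient is `1 / lam`-Lipschitz, with the corresponding
quadratic upper bound. -/
structure IsSmoothWith {d : ℕ} (F : Eu d → ℝ) (lam : ℝ) : Prop where
  differentiable : Differentiable ℝ F
  le_quadratic : ∀ x y,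
    F y ≤ F x + inner ℝ (gradient F x) (y - x) + 1 / (2 * lam) * ‖y - x‖ ^ 2
  norm_gradient_sub_le : ∀ x y, lam * ‖gradient F x - gradient F y‖ ≤ ‖x - y‖

lemma prox_eq {d : ℕ} {f : Eu d → EReal} {ell lam : ℝ} (hf : ClosedProper f)
    (h : WeaklyConvex f ell) (hlam : 0 < lam) (hle : 2 * ell < 1 / lam) (hell : 0 < ell)
    (x : Eu d) : prox f lam x = x - lam • gradient (moreau f lam) x := by
  rw [(hasGradientAt_moreau hf h hlam hle hell x).gradient, smul_smul,
    mul_inv_cancel₀ hlam.ne', one_smul]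
  abel

lemma isSmoothWith_moreau {d : ℕ} {f : Eu d → EReal} {ell lam : ℝ} (hf : ClosedProper f)
    (h : WeaklyConvex f ell) (hlam : 0 < lam) (hle : 2 * ell < 1 / lam) (hell : 0 < ell) :
    IsSmoothWith (moreau f lam) lam where
  differentiable x := (hasGradientAt_moreau hf h hlam hle hell x).differentiableAt
  le_quadratic x y := by
    rw [(hasGradientAt_moreau hf h hlam hle hell x).gradient]
    exact moreau_le_quadratic hf h hlam (by linarith) x y
  norm_gradient_sub_le x y := by
    rw [(hasGradientAt_moreau hf h hlam hle hell x).gradient,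
      (hasGradientAt_moreau hf h hlam hle hell y).gradient, ← smul_sub, norm_smul,
      Real.norm_of_nonneg (by positivity), mul_inv_cancel_left₀ hlam.ne']
    exact norm_sub_prox_sub_le hf h hlam hle hell x y

/-! ### Extreme eigenvalues of symmetric operators and the Hessian -/

lemma finite_hasEigenvalue {d : ℕ} (A : Eu d →L[ℝ] Eu d) :
    {μ : ℝ | Module.End.HasEigenvalue (A : Eu d →ₗ[ℝ] Eu d) μ}.Finite :=
  Module.End.finite_hasEigenvalue _

lemma nonempty_hasEigenvalue {d : ℕ} (hd : 0 < d) {A : Eu d →L[ℝ] Eu d}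
    (hA : (A : Eu d →ₗ[ℝ] Eu d).IsSymmetric) :
    {μ : ℝ | Module.End.HasEigenvalue (A : Eu d →ₗ[ℝ] Eu d) μ}.Nonempty :=
  ⟨_, hA.hasEigenvalue_eigenvalues (finrank_euclideanSpace_fin (𝕜 := ℝ) (n := d)) ⟨0, hd⟩⟩

lemma lambdaMin_le {d : ℕ} {A : Eu d →L[ℝ] Eu d} {μ : ℝ}
    (h : Module.End.HasEigenvalue (A : Eu d →ₗ[ℝ] Eu d) μ) : lambdaMin A ≤ μ :=
  csInf_le (finite_hasEigenvalue A).bddBelow h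

lemma exists_lambdaMin_eigenvector {d : ℕ} (hd : 0 < d) {A : Eu d →L[ℝ] Eu d}
    (hA : (A : Eu d →ₗ[ℝ] Eu d).IsSymmetric) :
    ∃ e : Eu d, ‖e‖ = 1 ∧ A e = lambdaMin A • e := by
  have h := (nonempty_hasEigenvalue hd hA).csInf_mem (finite_hasEigenvalue A)
  obtain ⟨v, hv⟩ := Module.End.HasEigenvalue.exists_hasEigenvector h
  refine ⟨‖v‖⁻¹ • v, norm_smul_inv_norm (𝕜 := ℝ) hv.2, ?_⟩
  have hv' : A v = lambdaMin A • v := hv.apply_eq_smul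
  rw [map_smul, hv', smul_comm]

lemma inner_eigenvectorBasis_apply {d : ℕ} {A : Eu d →L[ℝ] Eu d}
    (hA : (A : Eu d →ₗ[ℝ] Eu d).IsSymmetric) (x : Eu d) (i : Fin d) :
    inner ℝ (hA.eigenvectorBasis (finrank_euclideanSpace_fin (𝕜 := ℝ) (n := d)) i) (A x) =
      hA.eigenvalues (finrank_euclideanSpace_fin (𝕜 := ℝ) (n := d)) i *
      inner ℝ (hA.eigenvectorBasis (finrank_euclideanSpace_fin (𝕜 := ℝ) (n := d)) i) x := by
  have h := hA (hA.eigenvectorBasis (finrank_euclideanSpace_fin (𝕜 := ℝ) (n := d)) i) x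
  rw [hA.apply_eigenvectorBasis] at h
  rw [real_inner_smul_left] at h
  simpa using h.symm

lemma lambdaMin_mul_le_inner {d : ℕ} {A : Eu d →L[ℝ] Eu d}
    (hA : (A : Eu d →ₗ[ℝ] Eu d).IsSymmetric) (x : Eu d) :
    lambdaMin A * ‖x‖ ^ 2 ≤ inner ℝ (A x) x := by
  set b := hA.eigenvectorBasis (finrank_euclideanSpace_fin (𝕜 := ℝ) (n := d)) with hb
  rw [← b.sum_inner_mul_inner (A x) x, ← b.sum_sq_inner_right x, Finset.mul_sum]
  refine Finset.sum_le_sum fun i _ => ?_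
  rw [real_inner_comm (b i) (A x), inner_eigenvectorBasis_apply hA x i, ← hb, mul_assoc, ← sq]
  exact mul_le_mul_of_nonneg_right (lambdaMin_le (hA.hasEigenvalue_eigenvalues _ i)) (sq_nonneg _)

/-- In an eigenbasis the map multiplies by `1 - η * μ`; `hA1` gives `η * μ ≤ 1`, so these factors
lie between `0` and `1 - η * lambdaMin A`. -/
lemma norm_sub_smul_apply_le {d : ℕ} {A : Eu d →L[ℝ] Eu d} {η : ℝ}
    (hA : (A : Eu d →ₗ[ℝ] Eu d).IsSymmetric) (hη : 0 ≤ η) (hA1 : ∀ x, η * ‖A x‖ ≤ ‖x‖)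
    (hmin : lambdaMin A ≤ 0) (x : Eu d) :
    ‖x - η • A x‖ ≤ (1 - η * lambdaMin A) * ‖x‖ := by
  set b := hA.eigenvectorBasis (finrank_euclideanSpace_fin (𝕜 := ℝ) (n := d)) with hb
  have hc : 0 ≤ 1 - η * lambdaMin A := by nlinarith
  rw [← sq_le_sq₀ (norm_nonneg _) (by positivity), mul_pow, ← b.sum_sq_inner_right,
    ← b.sum_sq_inner_right x, Finset.mul_sum]
  refine Finset.sum_le_sum fun i _ => ?_
  rw [inner_sub_right, real_inner_smul_right, inner_eigenvectorBasis_apply hA x i, ← hb]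
  set μ := hA.eigenvalues (finrank_euclideanSpace_fin (𝕜 := ℝ) (n := d)) i with hμ
  have h1 : lambdaMin A ≤ μ := lambdaMin_le (hA.hasEigenvalue_eigenvalues _ i)
  have h2 : η * μ ≤ 1 := by
    have h3 := hA1 (b i)
    have h4 : A (b i) = μ • b i := hA.apply_eigenvectorBasis _ i
    rw [h4, norm_smul, b.norm_eq_one, mul_one, Real.norm_eq_abs] at h3
    exact (mul_le_mul_of_nonneg_left (le_abs_self μ) hη).trans h3
  have h5 : η * lambdaMin A ≤ η * μ := mul_le_mul_of_nonneg_left h1 hη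
  have e : inner ℝ (b i) x - η * (μ * inner ℝ (b i) x) = (1 - η * μ) * inner ℝ (b i) x := by ring
  rw [e, mul_pow]
  apply mul_le_mul_of_nonneg_right _ (sq_nonneg _)
  apply pow_le_pow_left₀ <;> linarith

lemma lambdaMax_id_sub_smul_le {d : ℕ} (hd : 0 < d) {A : Eu d →L[ℝ] Eu d} {η : ℝ}
    (hA : (A : Eu d →ₗ[ℝ] Eu d).IsSymmetric) (hη : 0 < η) :
    lambdaMax (ContinuousLinearMap.id ℝ (Eu d) - η • A) ≤ 1 - η * lambdaMin A := by
  have hB : ((ContinuousLinearMap.id ℝ (Eu d) - η • A : Eu d →L[ℝ] Eu d) :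
      Eu d →ₗ[ℝ] Eu d).IsSymmetric := by
    intro x y
    have := hA x y
    simp only [ContinuousLinearMap.coe_coe] at this
    simp [inner_sub_left, inner_sub_right, real_inner_smul_left, real_inner_smul_right, this]
  refine csSup_le (nonempty_hasEigenvalue hd hB) fun κ hκ => ?_
  obtain ⟨v, hv⟩ := Module.End.HasEigenvalue.exists_hasEigenvector hκ
  have h1 : v - η • A v = κ • v := hv.apply_eq_smul
  have h2 : A v = ((1 - κ) / η) • v := by
    have h3 : η • A v = (1 - κ) • v := by rw [sub_smul, one_smul, ← h1]; abel
    rw [div_eq_inv_mul, mul_smul, ← h3, smul_smul, inv_mul_cancel₀ hη.ne', one_smul]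
  have h4 : lambdaMin A ≤ (1 - κ) / η :=
    lambdaMin_le (Module.End.hasEigenvalue_of_hasEigenvector
      ⟨Module.End.mem_eigenspace_iff.2 h2, hv.2⟩)
  rw [le_div_iff₀ hη] at h4
  linarith

lemma isSymmetric_hessian {d : ℕ} {F : Eu d → ℝ} {x : Eu d} (h : TwiceDifferentiableAt F x) :
    ((hessian F x : Eu d →L[ℝ] Eu d) : Eu d →ₗ[ℝ] Eu d).IsSymmetric := by
  have h1 : ∀ᶠ y in nhds x, HasFDerivAt F (innerSL ℝ (gradient F y)) y := by
    filter_upwards [h.1] with y hy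
    exact hy.hasGradientAt.hasFDerivAt
  have h2 : HasFDerivAt (fun y => innerSL ℝ (gradient F y))
      ((innerSL ℝ : Eu d →L[ℝ] Eu d →L[ℝ] ℝ).comp (hessian F x)) x :=
    (innerSL ℝ : Eu d →L[ℝ] Eu d →L[ℝ] ℝ).hasFDerivAt.comp x h.2.hasFDerivAt
  intro v w
  have := second_derivative_symmetric_of_eventually h1 h2 v w
  simp only [ContinuousLinearMap.comp_apply, innerSL_apply_apply] at this
  simp only [ContinuousLinearMap.coe_coe]
  rw [this, real_inner_comm]

lemma IsSmoothWith.lipschitzWith_gradient {d : ℕ} {F : Eu d → ℝ} {lam : ℝ}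
    (hF : IsSmoothWith F lam) (hlam : 0 < lam) :
    LipschitzWith (Real.toNNReal lam⁻¹) (gradient F) :=
  LipschitzWith.of_dist_le_mul fun y z => by
    rw [dist_eq_norm, dist_eq_norm, Real.coe_toNNReal _ (by positivity), inv_mul_eq_div,
      le_div_iff₀' hlam]
    exact hF.norm_gradient_sub_le y z

lemma IsSmoothWith.norm_hessian_apply_le {d : ℕ} {F : Eu d → ℝ} {lam : ℝ} (hF : IsSmoothWith F lam)
    (hlam : 0 < lam) (x v : Eu d) : lam * ‖hessian F x v‖ ≤ ‖v‖ := by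
  have h1 : ‖hessian F x‖ ≤ lam⁻¹ := by
    have := norm_fderiv_le_of_lipschitz ℝ (hF.lipschitzWith_gradient hlam) (x₀ := x)
    rwa [Real.coe_toNNReal _ (by positivity)] at this
  have h2 := (hessian F x).le_of_opNorm_le h1 v
  rwa [inv_mul_eq_div, le_div_iff₀' hlam] at h2

/-- The derivative of the proximal map is `id - lam • hessian`, so its largest eigenvalue is
governed by the smallest one of the Hessian. -/
lemma good_of_lambdaMin {d : ℕ} (hd : 0 < d) {f : Eu d → EReal} {lam ρ ε s : ℝ} {x : Eu d}
    (hprox : ∀ x, prox f lam x = x - lam • gradient (moreau f lam) x) (hlam : 0 < lam)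
    (hs : 0 < s) (hH : HessianLipschitzNearCritical (moreau f lam) ρ ε s)
    (hx : ‖gradient (moreau f lam) x‖ ≤ ε)
    (hmin : -√(ρ * ε) < lambdaMin (hessian (moreau f lam) x)) : Good f lam ρ ε x := by
  have h2 := (hH x hx).1 x (Metric.mem_ball_self hs)
  have hd' : HasFDerivAt (prox f lam)
      (ContinuousLinearMap.id ℝ (Eu d) - lam • hessian (moreau f lam) x) x := by
    rw [show prox f lam = fun x => x - lam • gradient (moreau f lam) x from funext hprox]
    exact (hasFDerivAt_id x).sub (h2.2.hasFDerivAt.const_smul lam)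
  refine ⟨⟨h2, hx, hmin⟩, hx, hd'.differentiableAt, ?_⟩
  rw [hd'.fderiv]
  refine (lambdaMax_id_sub_smul_le hd (isSymmetric_hessian h2) hlam).trans_lt ?_
  nlinarith

/-- Near an approximate critical point the gradient is close to its linearization. -/
lemma HessianLipschitzNearCritical.norm_gradient_sub_sub_le {d : ℕ} {F : Eu d → ℝ} {ρ ε s r : ℝ}
    (hH : HessianLipschitzNearCritical F ρ ε s) (hρ : 0 < ρ) (hr : 0 < r) (hrs : r ≤ s)
    {x y z : Eu d} (hx : ‖gradient F x‖ ≤ ε) (hy : y ∈ Metric.ball x r) (hz : z ∈ Metric.ball x r) :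
    ‖gradient F y - gradient F z - hessian F x (y - z)‖ ≤ ρ * r * ‖y - z‖ := by
  obtain ⟨h1, h2⟩ := hH x hx
  have hsub : Metric.ball x r ⊆ Metric.ball x s := Metric.ball_subset_ball hrs
  refine (convex_ball x r).norm_image_sub_le_of_norm_hasFDerivWithin_le'
    (f' := fun w => hessian F w) (fun w hw => ?_) (fun w hw => ?_) hz hy
  · exact (h1 w (hsub hw)).2.hasFDerivAt.hasFDerivWithinAt
  · refine (h2 w (hsub hw) x (Metric.mem_ball_self (hr.trans_le hrs))).trans ?_
    rw [Metric.mem_ball, dist_eq_norm] at hw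
    gcongr

/-- A bottom unit eigenvector at `y` serves as test vector for the Rayleigh quotient at `x`. -/
lemma HessianLipschitzNearCritical.lambdaMin_le {d : ℕ} (hd : 0 < d) {F : Eu d → ℝ} {ρ ε s : ℝ}
    (hH : HessianLipschitzNearCritical F ρ ε s) (hρ : 0 < ρ) {x y : Eu d}
    (hx : ‖gradient F x‖ ≤ ε) (hy : y ∈ Metric.ball x s) :
    lambdaMin (hessian F x) ≤ lambdaMin (hessian F y) + ρ * s := by
  obtain ⟨h1, h2⟩ := hH x hx
  have hs : 0 < s := Metric.pos_of_mem_ball hy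
  have hx' := Metric.mem_ball_self (x := x) hs
  obtain ⟨e, he, hAe⟩ := exists_lambdaMin_eigenvector hd (isSymmetric_hessian (h1 y hy))
  have h3 := lambdaMin_mul_le_inner (isSymmetric_hessian (h1 x hx')) e
  have h4 : inner ℝ (hessian F x e) e = inner ℝ ((hessian F x - hessian F y) e) e +
      lambdaMin (hessian F y) := by
    rw [_root_.sub_apply, inner_sub_left, hAe, real_inner_smul_left,
      real_inner_self_eq_norm_sq, he]
    ring
  have h5 : inner ℝ ((hessian F x - hessian F y) e) e ≤ ρ * s := by
    refine (real_inner_le_norm _ _).trans ?_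
    rw [he, mul_one]
    refine ((hessian F x - hessian F y).le_opNorm e).trans ?_
    rw [he, mul_one]
    refine (h2 x hx' y hy).trans ?_
    rw [Metric.mem_ball, dist_eq_norm, norm_sub_rev] at hy
    gcongr
  rw [he] at h3
  linarith

/-- Moving by `s` along an eigenvector of the smallest eigenvalue decreases the function. -/
lemma HessianLipschitzNearCritical.exists_le {d : ℕ} (hd : 0 < d) {F : Eu d → ℝ} {ρ ε s r : ℝ}
    (hF : Differentiable ℝ F)
    (hH : HessianLipschitzNearCritical F ρ ε r) (hρ : 0 < ρ) (hs : 0 < s) (hsr : s < r) {x : Eu d}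
    (hx : ‖gradient F x‖ ≤ ε) :
    ∃ y, F y ≤ F x + lambdaMin (hessian F x) / 2 * s ^ 2 + ρ * r * s ^ 2 / 2 := by
  have hr : 0 < r := hs.trans hsr
  obtain ⟨e₀, he₀, hAe₀⟩ := exists_lambdaMin_eigenvector hd
    (isSymmetric_hessian ((hH x hx).1 x (Metric.mem_ball_self hr)))
  set γ := lambdaMin (hessian F x)
  -- The sign of the eigenvector is chosen so that the first-order term does not increase `F`.
  obtain ⟨e, he, hAe, hge⟩ : ∃ e : Eu d, ‖e‖ = 1 ∧ hessian F x e = γ • e ∧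
      inner ℝ (gradient F x) e ≤ 0 := by
    rcases le_total (inner ℝ (gradient F x) e₀) 0 with h | h
    · exact ⟨e₀, he₀, hAe₀, h⟩
    · exact ⟨-e₀, by simpa using he₀, by simp [hAe₀], by simpa [inner_neg_right] using h⟩
  refine ⟨x + s • e, ?_⟩
  -- The subtracted quadratics account for the curvature and for the linearization error, leaving
  -- `ψ' ≤ ⟪∇F x, e⟫ ≤ 0`.
  set ψ : ℝ → ℝ := fun t => F (x + t • e) - γ / 2 * t ^ 2 - ρ * r / 2 * t ^ 2 with hψ
  have hder : ∀ t, HasDerivAt ψ (inner ℝ (gradient F (x + t • e)) e - γ * t - ρ * r * t) t := by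
    intro t
    have h1 : HasDerivAt (fun t : ℝ => x + t • e) e t := by
      simpa using ((hasDerivAt_id t).smul_const e).const_add x
    have h2 := (hF (x + t • e)).hasGradientAt.hasFDerivAt.comp_hasDerivAt t h1
    have h3 : HasDerivAt (fun t : ℝ => F (x + t • e)) (inner ℝ (gradient F (x + t • e)) e) t :=
      h2
    have h4 : HasDerivAt (fun t : ℝ => t ^ 2) (2 * t) t := by
      simpa using hasDerivAt_pow 2 t
    exact ((h3.sub (h4.const_mul (γ / 2))).sub (h4.const_mul (ρ * r / 2))).congr_deriv (by ring)
  have hanti : AntitoneOn ψ (Set.Icc 0 s) := by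
    refine antitoneOn_of_deriv_nonpos (convex_Icc 0 s)
      (fun t _ => (hder t).continuousAt.continuousWithinAt)
      (fun t _ => (hder t).differentiableAt.differentiableWithinAt) fun t ht => ?_
    rw [interior_Icc] at ht
    rw [(hder t).deriv]
    have hmem : x + t • e ∈ Metric.ball x r := by
      rw [Metric.mem_ball, dist_eq_norm, add_sub_cancel_left, norm_smul, he, mul_one,
        Real.norm_of_nonneg ht.1.le]
      linarith [ht.2]
    have h1 := hH.norm_gradient_sub_sub_le hρ hr le_rfl hx hmem (Metric.mem_ball_self hr)
    rw [add_sub_cancel_left, map_smul, norm_smul, he, mul_one, Real.norm_of_nonneg ht.1.le,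
      hAe] at h1
    have h2 := (real_inner_le_norm (gradient F (x + t • e) - gradient F x - t • γ • e) e)
    rw [he, mul_one, inner_sub_left, inner_sub_left, real_inner_smul_left, real_inner_smul_left,
      real_inner_self_eq_norm_sq, he] at h2
    linarith
  have := hanti (Set.left_mem_Icc.2 hs.le) (Set.right_mem_Icc.2 hs.le) hs.le
  simp only [hψ, zero_smul, add_zero] at this
  linarith

/-! ### Gradient descent on a smooth function -/

section Descent

variable {d : ℕ} {F : Eu d → ℝ} {S : Eu d → Eu d} {lam : ℝ}

lemma IsSmoothWith.descent (hF : IsSmoothWith F lam) (hlam : 0 < lam)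
    (hS : ∀ x, S x = x - lam • gradient F x) (x : Eu d) :
    F (S x) ≤ F x - lam / 2 * ‖gradient F x‖ ^ 2 := by
  have h := hF.le_quadratic x (S x)
  have e : S x - x = -(lam • gradient F x) := by rw [hS]; abel
  rw [e, inner_neg_right, real_inner_smul_right, real_inner_self_eq_norm_sq, norm_neg, norm_smul,
    Real.norm_of_nonneg hlam.le] at h
  refine h.trans (le_of_eq ?_)
  field_simp
  ring

lemma IsSmoothWith.antitone_iterate (hF : IsSmoothWith F lam) (hlam : 0 < lam)
    (hS : ∀ x, S x = x - lam • gradient F x) (y : Eu d) : Antitone fun j => F (S^[j] y) := by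
  refine antitone_nat_of_succ_le fun j => ?_
  rw [Function.iterate_succ_apply']
  refine (hF.descent hlam hS _).trans ?_
  linarith [show 0 ≤ lam / 2 * ‖gradient F (S^[j] y)‖ ^ 2 by positivity]

/-- Improve or localize: each squared step is at most `2 * lam` times its decrease, and by
Cauchy–Schwarz the squared sum of `j` steps is at most `j` times the sum of their squares. -/
lemma IsSmoothWith.norm_iterate_sub_sq_le (hF : IsSmoothWith F lam) (hlam : 0 < lam)
    (hS : ∀ x, S x = x - lam • gradient F x) (y : Eu d) (j : ℕ) :
    ‖S^[j] y - y‖ ^ 2 ≤ j * (2 * lam * (F y - F (S^[j] y))) := by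
  induction j with
  | zero => simp
  | succ j ih =>
    rw [Function.iterate_succ_apply']
    set z := S^[j] y
    have h1 := hF.descent hlam hS z
    have e : S z - y = (z - y) + (S z - z) := by abel
    have h2 : ‖S z - z‖ ^ 2 ≤ 2 * lam * (F z - F (S z)) := by
      have : S z - z = -(lam • gradient F z) := by rw [hS]; abel
      rw [this, norm_neg, norm_smul, Real.norm_of_nonneg hlam.le, mul_pow]
      nlinarith
    set A := 2 * lam * (F y - F z)
    set B := 2 * lam * (F z - F (S z))
    have e2 : 2 * lam * (F y - F (S z)) = A + B := by simp only [A, B]; ring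
    rw [e2, e]
    have h3 : ‖(z - y) + (S z - z)‖ ≤ ‖z - y‖ + ‖S z - z‖ := norm_add_le _ _
    set a := ‖z - y‖
    set b := ‖S z - z‖
    have ha : 0 ≤ a := norm_nonneg _
    have hb : 0 ≤ b := norm_nonneg _
    push_cast
    have h4 : ‖(z - y) + (S z - z)‖ ^ 2 ≤ (a + b) ^ 2 := by gcongr
    refine h4.trans ?_
    rcases Nat.eq_zero_or_pos j with rfl | hj
    · have : a = 0 := by simp [a, z]
      have hA : A = 0 := by simp [A, z]
      rw [this, hA]; simp; linarith
    · have hj' : (0 : ℝ) < j := by exact_mod_cast hj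
      have h5 : 2 * (a * b) ≤ A + j * B := by
        have h6 : (a * b) ^ 2 ≤ (j * A) * B := by
          rw [mul_pow]; gcongr
          nlinarith [sq_nonneg a]
        have hA : 0 ≤ A := by nlinarith [sq_nonneg a]
        have hB : 0 ≤ B := by nlinarith [sq_nonneg b]
        have : (2 * (a * b)) ^ 2 ≤ (A + j * B) ^ 2 := by nlinarith [sq_nonneg (A - j * B)]
        exact le_of_abs_le (abs_le_of_sq_le_sq this (by positivity))
      nlinarith

lemma IsSmoothWith.perturb_le (hF : IsSmoothWith F lam) (hlam : 0 < lam) (x v : Eu d) :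
    F (x - lam • v) ≤ F x + lam * ‖v‖ * ‖gradient F x‖ + lam / 2 * ‖v‖ ^ 2 := by
  have h := hF.le_quadratic x (x - lam • v)
  have e : x - lam • v - x = -(lam • v) := by abel
  rw [e, inner_neg_right, real_inner_smul_right, norm_neg, norm_smul,
    Real.norm_of_nonneg hlam.le] at h
  have h1 : -(‖gradient F x‖ * ‖v‖) ≤ inner ℝ (gradient F x) v :=
    (abs_le.1 (abs_real_inner_le_norm _ _)).1
  have e2 : 1 / (2 * lam) * (lam * ‖v‖) ^ 2 = lam / 2 * ‖v‖ ^ 2 := by field_simp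
  rw [e2] at h
  nlinarith

/-- Two runs of gradient descent whose starting points differ by a bottom eigenvector of the
Hessian separate geometrically as long as both stay near the critical point. -/
lemma separation (hF : IsSmoothWith F lam) (hlam : 0 < lam)
    (hS : ∀ x, S x = x - lam • gradient F x) {ρ ε s : ℝ}
    (hH : HessianLipschitzNearCritical F ρ ε s) (hρ : 0 < ρ) (hs : 0 < s) {x : Eu d}
    (hx : ‖gradient F x‖ ≤ ε) (hmin : lambdaMin (hessian F x) ≤ 0) {m : ℕ} {y z : Eu d}
    (hyz : hessian F x (y - z) = lambdaMin (hessian F x) • (y - z))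
    (hy : ∀ j ≤ m, S^[j] y ∈ Metric.ball x s) (hz : ∀ j ≤ m, S^[j] z ∈ Metric.ball x s)
    (j : ℕ) (hj : j ≤ m) :
    ‖S^[j] y - S^[j] z - (1 - lam * lambdaMin (hessian F x)) ^ j • (y - z)‖ ≤
      ((1 - lam * lambdaMin (hessian F x) + lam * ρ * s) ^ j -
        (1 - lam * lambdaMin (hessian F x)) ^ j) * ‖y - z‖ := by
  have hsymm := isSymmetric_hessian ((hH x hx).1 x (Metric.mem_ball_self hs))
  set A := hessian F x with hA
  set G := 1 - lam * lambdaMin A with hG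
  have hG0 : 0 ≤ G := by nlinarith
  induction j with
  | zero => simp
  | succ j ih =>
    specialize ih (by omega)
    rw [Function.iterate_succ_apply', Function.iterate_succ_apply', hS, hS]
    have hE := hH.norm_gradient_sub_sub_le hρ hs le_rfl hx (hy j (by omega)) (hz j (by omega))
    rw [← hA] at hE
    set a := S^[j] y
    set b := S^[j] z
    set E := gradient F a - gradient F b - A (a - b) with hEdef
    set Q := a - b - G ^ j • (y - z) with hQ
    have e : a - lam • gradient F a - (b - lam • gradient F b) - G ^ (j + 1) • (y - z) =
        (Q - lam • A Q) - lam • E := by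
      have h1 : A Q = A (a - b) - G ^ j • (lambdaMin A • (y - z)) := by
        rw [hQ, map_sub, map_smul, hyz]
      rw [h1, hEdef, hQ, pow_succ]
      simp only [hG]
      module
    have h2 : ‖a - b‖ ≤ ‖Q‖ + G ^ j * ‖y - z‖ := by
      have : a - b = Q + G ^ j • (y - z) := by rw [hQ]; abel
      calc ‖a - b‖ = ‖Q + G ^ j • (y - z)‖ := by rw [← this]
        _ ≤ ‖Q‖ + ‖G ^ j • (y - z)‖ := norm_add_le _ _
        _ = _ := by rw [norm_smul, Real.norm_of_nonneg (by positivity)]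
    have h3 := norm_sub_smul_apply_le hsymm hlam.le (hF.norm_hessian_apply_le hlam x) hmin Q
    rw [e]
    -- With `σ = lam * ρ * s`, the factor `(G + σ) ^ j - G ^ j` solves `b (j + 1) = (G + σ) * b j +
    -- σ * G ^ j`, `b 0 = 0` exactly.
    calc ‖(Q - lam • A Q) - lam • E‖ ≤ ‖Q - lam • A Q‖ + ‖lam • E‖ := norm_sub_le _ _
      _ ≤ G * ‖Q‖ + lam * (ρ * s * (‖Q‖ + G ^ j * ‖y - z‖)) := by
        rw [norm_smul, Real.norm_of_nonneg hlam.le]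
        gcongr
        exact hE.trans (by gcongr)
      _ = (G + lam * ρ * s) * ‖Q‖ + lam * ρ * s * G ^ j * ‖y - z‖ := by ring
      _ ≤ (G + lam * ρ * s) * (((G + lam * ρ * s) ^ j - G ^ j) * ‖y - z‖) +
          lam * ρ * s * G ^ j * ‖y - z‖ := by gcongr
      _ = _ := by ring

/-- For `G ≥ 1` and `σ = lam * ρ * s`, `(G + σ) ^ m ≤ exp (σ * m) * G ^ m ≤ 3 / 2 * G ^ m`, so the
error in `separation` is at most half of the main term. -/
lemma half_pow_mul_le_norm_sub (hF : IsSmoothWith F lam) (hlam : 0 < lam)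
    (hS : ∀ x, S x = x - lam • gradient F x) {ρ ε s : ℝ}
    (hH : HessianLipschitzNearCritical F ρ ε s) (hρ : 0 < ρ) (hs : 0 < s) {x : Eu d}
    (hx : ‖gradient F x‖ ≤ ε) (hmin : lambdaMin (hessian F x) ≤ 0) {m : ℕ}
    (hm : lam * ρ * s * m ≤ 1 / 3) {y z : Eu d}
    (hyz : hessian F x (y - z) = lambdaMin (hessian F x) • (y - z))
    (hy : ∀ j ≤ m, S^[j] y ∈ Metric.ball x s) (hz : ∀ j ≤ m, S^[j] z ∈ Metric.ball x s) :
    (1 - lam * lambdaMin (hessian F x)) ^ m * ‖y - z‖ / 2 ≤ ‖S^[m] y - S^[m] z‖ := by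
  have h := separation hF hlam hS hH hρ hs hx hmin hyz hy hz m le_rfl
  set G := 1 - lam * lambdaMin (hessian F x) with hG
  have hG1 : 1 ≤ G := by nlinarith
  set σ := lam * ρ * s with hσ
  have hσ0 : 0 ≤ σ := by positivity
  have h1 : (G + σ) ^ m ≤ 3 / 2 * G ^ m := by
    have h2 : G + σ ≤ (1 + σ) * G := by nlinarith
    have h3 : (1 + σ) ^ m ≤ 3 / 2 := by
      have h4 : (1 + σ) ^ m ≤ Real.exp (σ * m) := by
        rw [mul_comm, Real.exp_nat_mul]
        gcongr
        linarith [Real.add_one_le_exp σ]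
      have h5 : Real.exp (σ * m) ≤ Real.exp (1 / 3) := Real.exp_le_exp.2 hm
      have h6 := Real.add_one_le_exp (-(1 / 3 : ℝ))
      have h7 : Real.exp (-(1 / 3 : ℝ)) * Real.exp (1 / 3) = 1 := by
        rw [← Real.exp_add]; simp
      nlinarith [Real.exp_pos (1 / 3 : ℝ)]
    calc (G + σ) ^ m ≤ ((1 + σ) * G) ^ m := by gcongr
      _ = (1 + σ) ^ m * G ^ m := mul_pow _ _ _
      _ ≤ _ := by gcongr
  have h8 : ‖G ^ m • (y - z)‖ ≤ ‖S^[m] y - S^[m] z‖ +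
      ‖S^[m] y - S^[m] z - G ^ m • (y - z)‖ := by
    have := norm_sub_le (S^[m] y - S^[m] z) (S^[m] y - S^[m] z - G ^ m • (y - z))
    simpa using this
  rw [norm_smul, Real.norm_of_nonneg (by positivity)] at h8
  have h9 : ((G + σ) ^ m - G ^ m) * ‖y - z‖ ≤ (1 / 2 * G ^ m) * ‖y - z‖ := by
    gcongr; linarith
  linarith

end Descent

/-! ### The volume of a set that is thin in one direction -/

lemma one_add_inv_pow_le_three (d : ℕ) : (1 + (d : ℝ)⁻¹) ^ d ≤ 3 := by
  rcases Nat.eq_zero_or_pos d with rfl | hd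
  · norm_num
  have hd' : (0 : ℝ) < d := by exact_mod_cast hd
  calc (1 + (d : ℝ)⁻¹) ^ d ≤ Real.exp ((d : ℝ)⁻¹) ^ d := by
        gcongr; linarith [Real.add_one_le_exp ((d : ℝ)⁻¹)]
    _ = Real.exp 1 := by rw [← Real.exp_nat_mul, mul_inv_cancel₀ hd'.ne']
    _ ≤ 3 := by linarith [Real.exp_one_lt_d9]

/-- The `K` translates of `W` by multiples of `w • e` are disjoint and lie in a ball of radius `r +
K * w ≤ (1 + 1 / d) * r`, whose volume exceeds that of the original ball by a factor at most `exp 1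
≤ 3`. No comparison of volumes across dimensions is needed; the loss of a factor `d` only enters a
logarithm. -/
lemma volume_thin_le {d : ℕ} (hd : 0 < d) {W : Set (Eu d)} (hWm : MeasurableSet W) {r w : ℝ}
    (hr : 0 < r) (hw : 0 < w) (hWr : W ⊆ Metric.closedBall 0 r) {e : Eu d} (he : ‖e‖ = 1)
    (hW : ∀ v ∈ W, ∀ v' ∈ W, ∀ k : ℕ, 0 < k → v - v' ≠ (k * w) • e) {K : ℕ}
    (hK : K * d * w ≤ r) :
    (K : ENNReal) * volume W ≤ 3 * volume (Metric.closedBall (0 : Eu d) r) := by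
  set U : ℕ → Set (Eu d) := fun k => (fun v => v + (-((k * w) • e))) ⁻¹' W with hU
  have hUm : ∀ k, MeasurableSet (U k) := fun k => hWm.preimage (by fun_prop)
  have hUv : ∀ k, volume (U k) = volume W := fun k => measure_preimage_add_right _ _ _
  have hdisj : Pairwise (Function.onFun Disjoint U) := by
    have key : ∀ i j : ℕ, i < j → Disjoint (U i) (U j) := by
      intro i j hij
      rw [Set.disjoint_left]
      intro v hi hj
      refine hW _ hi _ hj (j - i) (by omega) ?_
      rw [Nat.cast_sub hij.le]
      module
    intro i j hij
    rcases lt_or_gt_of_ne hij with h | h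
    · exact key i j h
    · exact (key j i h).symm
  have hsub : (⋃ k ∈ Finset.range K, U k) ⊆ Metric.closedBall 0 (r + K * w) := by
    intro v hv
    simp only [Finset.mem_range, Set.mem_iUnion, exists_prop] at hv
    obtain ⟨k, hk, hv⟩ := hv
    have h1 := hWr hv
    rw [mem_closedBall_zero_iff] at h1 ⊢
    have h2 : ‖(k * w) • e‖ ≤ K * w := by
      rw [norm_smul, he, mul_one, Real.norm_of_nonneg (by positivity)]
      gcongr
    calc ‖v‖ = ‖(v + (-((k * w) • e))) + (k * w) • e‖ := by congr 1; abel
      _ ≤ _ := norm_add_le _ _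
      _ ≤ _ := add_le_add h1 h2
  have hsum : volume (⋃ k ∈ Finset.range K, U k) = K * volume W := by
    rw [measure_biUnion_finset (fun i _ j _ hij => hdisj hij) (fun k _ => hUm k)]
    simp [hUv]
  rw [← hsum]
  refine (measure_mono hsub).trans ?_
  rw [Measure.addHaar_closedBall _ _ (by positivity), Measure.addHaar_closedBall _ _ hr.le,
    ← mul_assoc]
  gcongr
  rw [show (3 : ENNReal) = ENNReal.ofReal 3 by simp, ← ENNReal.ofReal_mul (by norm_num)]
  apply ENNReal.ofReal_le_ofReal
  rw [finrank_euclideanSpace_fin]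
  have hd' : (0 : ℝ) < d := by exact_mod_cast hd
  calc (r + K * w) ^ d ≤ ((1 + (d : ℝ)⁻¹) * r) ^ d := by
        gcongr
        have : K * w ≤ (d : ℝ)⁻¹ * r := by
          rw [inv_mul_eq_div, le_div_iff₀ hd']; linarith
        linarith
    _ = (1 + (d : ℝ)⁻¹) ^ d * r ^ d := mul_pow _ _ _
    _ ≤ 3 * r ^ d := by gcongr; exact one_add_inv_pow_le_three d

/-! ### The parameters -/

/-- The standing assumptions on the parameters. -/
structure Admissible (lam ρ ε ι : ℝ) : Prop where
  lam_pos : 0 < lam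
  rho_pos : 0 < ρ
  eps_pos : 0 < ε
  eps_lt : ε < 1 / (lam ^ 2 * ρ)
  le_iota : 1000 ≤ ι

/-- The number of rounds from one perturbation to the earliest possible next one. -/
def windowLength (lam ρ ε ι : ℝ) : ℕ := ⌊pertInterval lam ρ ε ι⌋₊ + 1

lemma pertInterval_eq (lam ρ ε ι : ℝ) : pertInterval lam ρ ε ι = ι / (lam * √(ρ * ε)) := by
  rw [pertInterval]; ring

lemma lt_windowLength (lam ρ ε ι : ℝ) : pertInterval lam ρ ε ι < windowLength lam ρ ε ι := by
  unfold windowLength; push_cast; exact Nat.lt_floor_add_one _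

lemma decrease_eq_of_pos {ρ ε ι : ℝ} (hρ : 0 < ρ) (hε : 0 < ε) (hι : 0 < ι) :
    decrease ρ ε ι = ε ^ 2 / (50 * ι ^ 3 * √(ρ * ε)) := by
  have hq : 0 < √(ρ * ε) := Real.sqrt_pos.2 (mul_pos hρ hε)
  have e : √(ε ^ 3 / ρ) = ε ^ 2 / √(ρ * ε) := by
    rw [Real.sqrt_eq_iff_mul_self_eq_of_pos (by positivity), div_mul_div_comm, ← sq (√_),
      Real.sq_sqrt (mul_pos hρ hε).le]
    field_simp
  rw [decrease, e]
  field_simp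

/-- For `ι ≥ 1` the first entry of the maximum dominates, and `ρ` cancels in it. -/
lemma numIter_eq_of_pos {lam ρ ε ι Δ : ℝ} (hl : 0 < lam) (hρ : 0 < ρ) (hε : 0 < ε) (hι : 1 ≤ ι)
    (hΔ : 0 ≤ Δ) : numIter lam ρ ε ι Δ = 400 * ι ^ 4 * (Δ / (lam * ε ^ 2)) := by
  have hq : 0 < √(ρ * ε) := Real.sqrt_pos.2 (mul_pos hρ hε)
  have hι0 : 0 < ι := by linarith
  have e1 : Δ / (decrease ρ ε ι / (2 * pertInterval lam ρ ε ι)) =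
      100 * ι ^ 4 * (Δ / (lam * ε ^ 2)) := by
    rw [decrease_eq_of_pos hρ hε hι0, pertInterval_eq]
    generalize √(ρ * ε) = q at hq
    field_simp
    ring
  have e2 : Δ / (lam * ε ^ 2 / 2) = 2 * (Δ / (lam * ε ^ 2)) := by field_simp
  have h4 : 1 ≤ ι ^ 4 := one_le_pow₀ hι
  have hD : 0 ≤ Δ / (lam * ε ^ 2) := by positivity
  rw [numIter, e1, e2, max_eq_left (by nlinarith)]
  ring

namespace Admissible

variable {lam ρ ε ι : ℝ}

lemma iota_pos (h : Admissible lam ρ ε ι) : 0 < ι := lt_of_lt_of_le (by norm_num) h.le_iota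

lemma sqrt_pos (h : Admissible lam ρ ε ι) : 0 < √(ρ * ε) :=
  Real.sqrt_pos.2 (mul_pos h.rho_pos h.eps_pos)

lemma sqrt_sq (h : Admissible lam ρ ε ι) : √(ρ * ε) ^ 2 = ρ * ε :=
  Real.sq_sqrt (mul_pos h.rho_pos h.eps_pos).le

lemma lam_mul_sqrt_lt_one (h : Admissible lam ρ ε ι) : lam * √(ρ * ε) < 1 := by
  have h1 := h.eps_lt
  rw [lt_div_iff₀ (by have := h.lam_pos; have := h.rho_pos; positivity)] at h1
  have h2 := h.sqrt_sq
  have : (lam * √(ρ * ε)) ^ 2 < 1 := by rw [mul_pow, h2]; linarith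
  exact lt_of_pow_lt_pow_left₀ 2 zero_le_one (by simpa using this)

lemma locRadius_eq (h : Admissible lam ρ ε ι) : locRadius ρ ε ι = ε / (4 * ι * √(ρ * ε)) := by
  have hq := h.sqrt_pos
  have hι := h.iota_pos
  have hε := h.eps_pos
  have hρ := h.rho_pos
  have e : √(ε / ρ) = ε / √(ρ * ε) := by
    rw [Real.sqrt_eq_iff_mul_self_eq_of_pos (by positivity), div_mul_div_comm, ← sq (√_), h.sqrt_sq]
    field_simp
  rw [locRadius, e]
  field_simp

lemma decrease_eq (h : Admissible lam ρ ε ι) :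
    decrease ρ ε ι = ε ^ 2 / (50 * ι ^ 3 * √(ρ * ε)) :=
  decrease_eq_of_pos h.rho_pos h.eps_pos h.iota_pos

lemma pertInterval_ge (h : Admissible lam ρ ε ι) : 1000 ≤ pertInterval lam ρ ε ι := by
  have hq := h.sqrt_pos
  have hl := h.lam_pos
  rw [pertInterval_eq, le_div_iff₀ (by positivity)]
  nlinarith [h.le_iota, h.lam_mul_sqrt_lt_one]

lemma windowLength_le (h : Admissible lam ρ ε ι) :
    (windowLength lam ρ ε ι : ℝ) ≤ 1001 / 1000 * (ι / (lam * √(ρ * ε))) := by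
  have h1 := h.pertInterval_ge
  have h2 := Nat.floor_le (show 0 ≤ pertInterval lam ρ ε ι by linarith)
  unfold windowLength; push_cast; rw [← pertInterval_eq]; linarith

lemma windowLength_mul_le (h : Admissible lam ρ ε ι) :
    windowLength lam ρ ε ι * (lam * √(ρ * ε)) ≤ 1001 / 1000 * ι := by
  have hu : 0 < lam * √(ρ * ε) := mul_pos h.lam_pos h.sqrt_pos
  have := h.windowLength_le
  rwa [← mul_div_assoc, le_div_iff₀ hu] at this

lemma iota_lt_windowLength_mul (h : Admissible lam ρ ε ι) :
    ι < windowLength lam ρ ε ι * (lam * √(ρ * ε)) := by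
  have hu : 0 < lam * √(ρ * ε) := mul_pos h.lam_pos h.sqrt_pos
  have := lt_windowLength lam ρ ε ι
  rwa [pertInterval_eq, div_lt_iff₀ hu] at this

lemma locRadius_pos (h : Admissible lam ρ ε ι) : 0 < locRadius ρ ε ι := by
  rw [h.locRadius_eq]
  have := h.sqrt_pos; have := h.iota_pos; have := h.eps_pos
  positivity

lemma rho_mul_locRadius (h : Admissible lam ρ ε ι) : ρ * locRadius ρ ε ι = √(ρ * ε) / (4 * ι) := by
  have hq := h.sqrt_pos
  have hι := h.iota_pos
  rw [h.locRadius_eq]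
  field_simp
  rw [h.sqrt_sq]

lemma decrease_pos (h : Admissible lam ρ ε ι) : 0 < decrease ρ ε ι := by
  rw [h.decrease_eq]
  have := h.sqrt_pos; have := h.iota_pos; have := h.eps_pos
  positivity

lemma pertRadius_pos (h : Admissible lam ρ ε ι) : 0 < pertRadius ε ι := by
  have := h.iota_pos; have := h.eps_pos
  unfold pertRadius
  positivity

lemma pertRadius_le (h : Admissible lam ρ ε ι) : pertRadius ε ι ≤ ε / 400 := by
  have := h.le_iota; have := h.eps_pos
  unfold pertRadius
  gcongr
  have : 1 ≤ ι ^ 3 := one_le_pow₀ (by linarith)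
  linarith

lemma numIter_eq (h : Admissible lam ρ ε ι) {Δ : ℝ} (hΔ : 0 ≤ Δ) :
    numIter lam ρ ε ι Δ = 400 * ι ^ 4 * (Δ / (lam * ε ^ 2)) :=
  numIter_eq_of_pos h.lam_pos h.rho_pos h.eps_pos (by linarith [h.le_iota]) hΔ

/-- An initial gap of at least the function decrease bounds the window length by the number of
iterations. -/
lemma windowLength_le_numIter (h : Admissible lam ρ ε ι) {Δ : ℝ} (hΔ : decrease ρ ε ι ≤ Δ) :
    8 * (windowLength lam ρ ε ι : ℝ) ≤ 1001 / 1000 * numIter lam ρ ε ι Δ := by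
  have hq := h.sqrt_pos; have hι := h.iota_pos; have hε := h.eps_pos; have hl := h.lam_pos
  have h1 := h.windowLength_le
  rw [h.numIter_eq (h.decrease_pos.le.trans hΔ)]
  have h2 : 400 * ι ^ 4 * (decrease ρ ε ι / (lam * ε ^ 2)) = 8 * (ι / (lam * √(ρ * ε))) := by
    rw [h.decrease_eq]
    field_simp
    ring
  have h3 : 400 * ι ^ 4 * (decrease ρ ε ι / (lam * ε ^ 2)) ≤
      400 * ι ^ 4 * (Δ / (lam * ε ^ 2)) := by gcongr
  linarith

/-- The degree 10 Taylor term of the exponential suffices: its surplus factor `ι ≥ 10 ^ 30` exceeds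
all the constants. -/
lemma iota_pow_le_exp (hι : (10 : ℝ) ^ 30 ≤ ι) : 54000000 * ι ^ 9 ≤ Real.exp (ι / 8) := by
  have hι0 : 0 < ι := lt_of_lt_of_le (by norm_num) hι
  have h1 := Real.pow_div_factorial_le_exp (ι / 8) (by positivity) 10
  refine le_trans ?_ h1
  rw [div_pow, div_div, le_div_iff₀ (by positivity)]
  have h2 : (Nat.factorial 10 : ℝ) = 3628800 := by norm_num [Nat.factorial]
  rw [h2]
  have h3 : 54000000 * ι ^ 9 * (8 ^ 10 * 3628800) = ι ^ 9 * (54000000 * (8 ^ 10 * 3628800)) := by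
    ring
  rw [h3, pow_succ ι 9]
  gcongr
  refine le_trans ?_ hι
  norm_num

/-- The number of rounds is negligible compared with the exponential separation in a window. -/
lemma union_bound (h : Admissible lam ρ ε ι) {d : ℕ} (hd : 0 < d) {Δ δ : ℝ} {N : ℕ}
    (hΔ : decrease ρ ε ι ≤ Δ) (hδ0 : 0 < δ)
    (hδ1 : δ < 1) (hι : (10 : ℝ) ^ 30 ≤ ι)
    (hlog : (10 : ℝ) ^ 30 * Real.log (d * Δ / (lam * ε ^ 2 * δ)) ≤ ι)
    (hN : (N : ℝ) ≤ numIter lam ρ ε ι Δ + 1) :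
    6 * N / δ * d * (4 * locRadius ρ ε ι / (lam * Real.exp (ι / 4))) ≤ pertRadius ε ι := by
  have hq := h.sqrt_pos; have hι0 := h.iota_pos; have hε := h.eps_pos; have hl := h.lam_pos
  have hΔ0 : 0 < Δ := h.decrease_pos.trans_le hΔ
  have hd1 : (1 : ℝ) ≤ d := by exact_mod_cast hd
  set D := Δ / (lam * ε ^ 2) with hD
  have hD0 : 0 < D := by positivity
  set X := d * Δ / (lam * ε ^ 2 * δ) with hX
  have hXD : X * δ = d * D := by rw [hX, hD]; field_simp
  have hX0 : 0 < X := by positivity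
  have hDX : D ≤ X := by nlinarith
  have hXE : X ^ 2 ≤ Real.exp (ι / 8) := by
    have h1 : Real.log X ≤ ι / 16 := by nlinarith
    have h2 : X ≤ Real.exp (ι / 16) := (Real.log_le_iff_le_exp hX0).1 h1
    calc X ^ 2 ≤ Real.exp (ι / 16) ^ 2 := by gcongr
      _ = Real.exp (ι / 8) := by rw [← Real.exp_nat_mul]; congr 1; push_cast; ring
  set u := lam * √(ρ * ε) with hu
  have hu0 : 0 < u := mul_pos hl hq
  have hu1 : u < 1 := h.lam_mul_sqrt_lt_one
  -- This is `decrease ≤ Δ` rewritten. It is the only control on `1 / u`, which the logarithm in `ι`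
  -- does not see.
  have h1 : 1 ≤ 50 * ι ^ 3 * u * D := by
    have e : 50 * ι ^ 3 * u * (decrease ρ ε ι / (lam * ε ^ 2)) = 1 := by
      rw [h.decrease_eq, hu]; field_simp
    rw [← e, hD]
    gcongr
  have hN' : (N : ℝ) ≤ 450 * ι ^ 4 * D := by
    rw [h.numIter_eq hΔ0.le, ← hD] at hN
    have h2 : ι ^ 3 * u * D ≤ ι ^ 4 * D := by
      have : ι ^ 3 * u ≤ ι ^ 3 * ι := by gcongr; linarith [h.le_iota]
      nlinarith
    nlinarith
  have hND : (N : ℝ) * d ≤ 450 * ι ^ 4 * X * δ := by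
    calc (N : ℝ) * d ≤ 450 * ι ^ 4 * D * d := by gcongr
      _ = 450 * ι ^ 4 * X * δ := by rw [mul_assoc _ X, hXD]; ring
  have hexp : Real.exp (ι / 4) = Real.exp (ι / 8) * Real.exp (ι / 8) := by
    rw [← Real.exp_add]; congr 1; ring
  have hfin : 54000000 * ι ^ 9 * X ^ 2 ≤ Real.exp (ι / 4) := by
    rw [hexp]
    exact mul_le_mul (iota_pow_le_exp hι) hXE (by positivity) (by positivity)
  have hkey : 2400 * ι ^ 2 * (N * d) ≤ δ * u * Real.exp (ι / 4) := by
    calc 2400 * ι ^ 2 * (N * d) ≤ 2400 * ι ^ 2 * (450 * ι ^ 4 * X * δ) := by gcongr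
      _ = 1080000 * ι ^ 6 * X * δ * 1 := by ring
      _ ≤ 1080000 * ι ^ 6 * X * δ * (50 * ι ^ 3 * u * D) := by gcongr
      _ ≤ 1080000 * ι ^ 6 * X * δ * (50 * ι ^ 3 * u * X) := by gcongr
      _ = δ * u * (54000000 * ι ^ 9 * X ^ 2) := by ring
      _ ≤ _ := by gcongr
  rw [h.locRadius_eq, pertRadius]
  have e : 6 * N / δ * d * (4 * (ε / (4 * ι * √(ρ * ε))) / (lam * Real.exp (ι / 4))) =
      (6 * (N * d) * ε) / (δ * ι * u * Real.exp (ι / 4)) := by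
    rw [hu]; field_simp
  rw [e, div_le_div_iff₀ (by positivity) (by positivity)]
  calc 6 * (N * d) * ε * (400 * ι ^ 3) = ε * ι * (2400 * ι ^ 2 * (N * d)) := by ring
    _ ≤ ε * ι * (δ * u * Real.exp (ι / 4)) := by gcongr
    _ = _ := by ring

end Admissible

/-! ### Escaping from saddle points -/

section Escape

variable {d : ℕ} {F : Eu d → ℝ} {S : Eu d → Eu d} {lam ρ ε ι : ℝ}

/-- A perturbed run that has not decreased the function stays near its starting point. -/
lemma iterate_mem_ball (h : Admissible lam ρ ε ι) (hF : IsSmoothWith F lam)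
    (hS : ∀ x, S x = x - lam • gradient F x) {x v : Eu d} (hx : ‖gradient F x‖ ≤ ε)
    (hv : ‖v‖ ≤ pertRadius ε ι) {j : ℕ} (hj : j ≤ windowLength lam ρ ε ι)
    (hj' : F x - decrease ρ ε ι / 2 ≤ F (S^[j] (x - lam • v))) :
    S^[j] (x - lam • v) ∈ Metric.ball x (locRadius ρ ε ι) := by
  have hq := h.sqrt_pos; have hι0 := h.iota_pos; have hε := h.eps_pos; have hl := h.lam_pos
  have hι := h.le_iota
  set y := x - lam • v with hy
  set u := lam * √(ρ * ε) with hu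
  have hu0 : 0 < u := mul_pos hl hq
  have hu1 : u < 1 := h.lam_mul_sqrt_lt_one
  have h1 := hF.norm_iterate_sub_sq_le hl hS y j
  have h2 := hF.perturb_le hl x v
  have hr := h.pertRadius_le
  have hr0 := h.pertRadius_pos
  set B := ε / (ι * √(ρ * ε)) with hB
  have hB0 : 0 < B := by positivity
  have hlr : lam * pertRadius ε ι ≤ B / 400 := by
    have e : lam * pertRadius ε ι = u * B / (400 * ι ^ 2) := by
      rw [pertRadius, hB, hu]; generalize √(ρ * ε) = q at hq; field_simp
    rw [e]
    have h1ι : (1 : ℝ) ≤ ι ^ 2 := one_le_pow₀ (by linarith)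
    gcongr
    · nlinarith
    · nlinarith
  have h3 : F y ≤ F x + 11 / 4000 * (B ^ 2 * √(ρ * ε) / ι) := by
    have e : lam * pertRadius ε ι * ε = u * (1 / 400 * (B ^ 2 * √(ρ * ε) / ι)) := by
      rw [pertRadius, hB, hu]; generalize √(ρ * ε) = q at hq; field_simp
    have h4 : lam * ‖v‖ * ‖gradient F x‖ ≤ lam * pertRadius ε ι * ε := by gcongr
    have h5 : lam / 2 * ‖v‖ ^ 2 ≤ lam / 2 * (pertRadius ε ι * (ε / 400)) := by
      gcongr
      rw [sq]; gcongr
      exact hv.trans hr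
    have h6 : 0 < B ^ 2 * √(ρ * ε) / ι := by positivity
    have h7 : lam * pertRadius ε ι * ε ≤ 1 / 400 * (B ^ 2 * √(ρ * ε) / ι) := by
      rw [e]; nlinarith
    linarith
  have hdec : decrease ρ ε ι = 1 / 50 * (B ^ 2 * √(ρ * ε) / ι) := by
    rw [h.decrease_eq, hB]; field_simp
  have h4 : ‖S^[j] y - y‖ ^ 2 ≤ (B / 6) ^ 2 := by
    have h5 : F y - F (S^[j] y) ≤ 51 / 4000 * (B ^ 2 * √(ρ * ε) / ι) := by linarith
    have hjm : (j : ℝ) ≤ windowLength lam ρ ε ι := by exact_mod_cast hj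
    have hm := h.windowLength_mul_le
    rw [← hu] at hm
    calc ‖S^[j] y - y‖ ^ 2 ≤ j * (2 * lam * (F y - F (S^[j] y))) := h1
      _ ≤ j * (2 * lam * (51 / 4000 * (B ^ 2 * √(ρ * ε) / ι))) := by gcongr
      _ ≤ windowLength lam ρ ε ι * (2 * lam * (51 / 4000 * (B ^ 2 * √(ρ * ε) / ι))) := by gcongr
      _ = (windowLength lam ρ ε ι * u) * (51 / 2000 * (B ^ 2 / ι)) := by rw [hu]; ring
      _ ≤ (1001 / 1000 * ι) * (51 / 2000 * (B ^ 2 / ι)) := by gcongr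
      _ = 51051 / 2000000 * B ^ 2 := by field_simp; norm_num
      _ ≤ _ := by nlinarith [sq_nonneg B]
  have h5 : ‖S^[j] y - y‖ ≤ B / 6 := (sq_le_sq₀ (norm_nonneg _) (by positivity)).1 h4
  have h6 : ‖y - x‖ ≤ B / 400 := by
    rw [hy, sub_sub_cancel_left, norm_neg, norm_smul, Real.norm_of_nonneg hl.le]
    refine le_trans ?_ hlr
    gcongr
  have hloc : locRadius ρ ε ι = B / 4 := by rw [h.locRadius_eq, hB]; field_simp
  rw [Metric.mem_ball, dist_eq_norm, hloc]
  calc ‖S^[j] y - x‖ = ‖(S^[j] y - y) + (y - x)‖ := by congr 1; abel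
    _ ≤ B / 6 + B / 400 := (norm_add_le _ _).trans (add_le_add h5 h6)
    _ < B / 4 := by linarith

/-- Below a strict saddle point there is room for two function decreases. -/
lemma exists_le_sub_decrease (hd : 0 < d) (h : Admissible lam ρ ε ι) (hF : IsSmoothWith F lam)
    (hH : HessianLipschitzNearCritical F ρ ε (locRadius ρ ε ι)) {x : Eu d}
    (hx : ‖gradient F x‖ ≤ ε) (hmin : lambdaMin (hessian F x) ≤ -(√(ρ * ε) / 2)) :
    ∃ y, F y ≤ F x - 2 * decrease ρ ε ι := by
  have hq := h.sqrt_pos; have hι0 := h.iota_pos; have hε := h.eps_pos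
  have hι := h.le_iota
  have hR := h.locRadius_pos
  -- The curvature gain at this distance is at least `50 / 256 * ι * decrease`, ample since `ι ≥
  -- 1000`; the error term is at least 2000 times smaller than this gain.
  obtain ⟨y, hy⟩ := hH.exists_le hd hF.differentiable h.rho_pos
    (s := locRadius ρ ε ι / 2) (by linarith) (by linarith) hx
  refine ⟨y, hy.trans ?_⟩
  rw [h.rho_mul_locRadius]
  have h1 : lambdaMin (hessian F x) / 2 * (locRadius ρ ε ι / 2) ^ 2 ≤
      -(√(ρ * ε) / 2) / 2 * (locRadius ρ ε ι / 2) ^ 2 := by gcongr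
  have h2 : √(ρ * ε) / (4 * ι) ≤ √(ρ * ε) / 4000 := by
    gcongr; linarith
  have h3 : √(ρ * ε) / (4 * ι) * (locRadius ρ ε ι / 2) ^ 2 / 2 ≤
      √(ρ * ε) / 4000 * (locRadius ρ ε ι / 2) ^ 2 / 2 := by gcongr
  have h4 : √(ρ * ε) * (locRadius ρ ε ι / 2) ^ 2 = ι * (50 / 64 * decrease ρ ε ι) := by
    rw [h.locRadius_eq, h.decrease_eq]
    field_simp
    norm_num
  have h5 := h.decrease_pos
  nlinarith

/-- With `u = lam * √(ρ * ε) < 1`, each step expands by at least `1 + u / 2 ≥ exp (u / 4)`, and the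
window has more than `ι / u` steps. -/
lemma exp_le_pow_windowLength (h : Admissible lam ρ ε ι) {γ : ℝ} (hγ : γ ≤ -(√(ρ * ε) / 2)) :
    Real.exp (ι / 4) ≤ (1 - lam * γ) ^ windowLength lam ρ ε ι := by
  have hl := h.lam_pos
  set u := lam * √(ρ * ε) with hu
  have hu0 : 0 < u := mul_pos hl h.sqrt_pos
  have hu1 : u < 1 := h.lam_mul_sqrt_lt_one
  have h1 : Real.exp (u / 4) ≤ 1 + u / 2 := by
    have := Real.abs_exp_sub_one_le (x := u / 4) (by rw [abs_of_pos] <;> linarith)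
    rw [abs_of_pos (show 0 < u / 4 by linarith)] at this
    linarith [le_abs_self (Real.exp (u / 4) - 1)]
  have h2 : 1 + u / 2 ≤ 1 - lam * γ := by rw [hu]; nlinarith
  have h3 := h.iota_lt_windowLength_mul
  calc Real.exp (ι / 4) ≤ Real.exp (windowLength lam ρ ε ι * (u / 4)) := by
        apply Real.exp_le_exp.2; rw [← hu] at h3; linarith
    _ = Real.exp (u / 4) ^ windowLength lam ρ ε ι := Real.exp_nat_mul _ _
    _ ≤ _ := by gcongr; exact h1.trans h2

/-- The perturbations of `x` after which gradient descent does not decrease the function. -/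
def stuck (F : Eu d → ℝ) (S : Eu d → Eu d) (lam ρ ε ι : ℝ) (x : Eu d) : Set (Eu d) :=
  {v | F x - decrease ρ ε ι / 2 < F (S^[windowLength lam ρ ε ι] (x - lam • v))}

/-- Both runs stay in a ball of radius `locRadius`, hence less than `2 * locRadius` apart, whereas
starting points `lam * t` apart along `e` separate to at least `exp (ι / 4) * lam * t / 2 ≥ 2 *
locRadius`. -/
lemma sub_ne_of_mem_stuck (h : Admissible lam ρ ε ι) (hF : IsSmoothWith F lam)
    (hS : ∀ x, S x = x - lam • gradient F x)
    (hH : HessianLipschitzNearCritical F ρ ε (locRadius ρ ε ι)) {x : Eu d}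
    (hx : ‖gradient F x‖ ≤ ε) (hmin : lambdaMin (hessian F x) ≤ -(√(ρ * ε) / 2))
    {e : Eu d} (he : ‖e‖ = 1) (hAe : hessian F x e = lambdaMin (hessian F x) • e)
    {v v' : Eu d} (hv : v ∈ stuck F S lam ρ ε ι x) (hv' : v' ∈ stuck F S lam ρ ε ι x)
    (hvr : ‖v‖ ≤ pertRadius ε ι) (hvr' : ‖v'‖ ≤ pertRadius ε ι) {t : ℝ}
    (ht : 4 * locRadius ρ ε ι / (lam * Real.exp (ι / 4)) ≤ t) : v - v' ≠ t • e := by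
  intro hvv
  have hl := h.lam_pos; have hι0 := h.iota_pos
  have hR := h.locRadius_pos
  have hq := h.sqrt_pos
  have hmem : ∀ w ∈ stuck F S lam ρ ε ι x, ‖w‖ ≤ pertRadius ε ι →
      ∀ j ≤ windowLength lam ρ ε ι, S^[j] (x - lam • w) ∈ Metric.ball x (locRadius ρ ε ι) := by
    intro w hw hwr j hj
    have hw' : F x - decrease ρ ε ι / 2 < F (S^[windowLength lam ρ ε ι] (x - lam • w)) := hw
    exact iterate_mem_ball h hF hS hx hwr hj
      (hw'.le.trans (hF.antitone_iterate hl hS (x - lam • w) hj))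
  have hdiff : (x - lam • v) - (x - lam • v') = (-(lam * t)) • e := by
    have : (x - lam • v) - (x - lam • v') = -(lam • (v - v')) := by module
    rw [this, hvv]; module
  have hσ : lam * ρ * locRadius ρ ε ι * windowLength lam ρ ε ι ≤ 1 / 3 := by
    have e : lam * ρ * locRadius ρ ε ι * windowLength lam ρ ε ι =
        windowLength lam ρ ε ι * (lam * √(ρ * ε)) / (4 * ι) := by
      rw [mul_assoc lam ρ, h.rho_mul_locRadius]; ring
    rw [e, div_le_iff₀ (by positivity)]
    linarith [h.windowLength_mul_le]
  have ht0 : 0 < t := lt_of_lt_of_le (by positivity) ht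
  have hsep := half_pow_mul_le_norm_sub hF hl hS hH h.rho_pos hR hx (by linarith) hσ
    (by rw [hdiff, map_smul, hAe, smul_comm]) (hmem v hv hvr) (hmem v' hv' hvr')
  rw [hdiff, norm_smul, he, mul_one, norm_neg, Real.norm_of_nonneg (by positivity)] at hsep
  have h1 := hmem v hv hvr _ le_rfl
  have h2 := hmem v' hv' hvr' _ le_rfl
  have h3 : ‖S^[windowLength lam ρ ε ι] (x - lam • v) -
      S^[windowLength lam ρ ε ι] (x - lam • v')‖ < 2 * locRadius ρ ε ι := by
    rw [← dist_eq_norm]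
    rw [Metric.mem_ball] at h1 h2
    linarith [dist_triangle_right (S^[windowLength lam ρ ε ι] (x - lam • v))
      (S^[windowLength lam ρ ε ι] (x - lam • v')) x]
  have h4 := exp_le_pow_windowLength h hmin
  rw [div_le_iff₀ (by positivity)] at ht
  have h5 : Real.exp (ι / 4) * (lam * t) ≤
      (1 - lam * lambdaMin (hessian F x)) ^ windowLength lam ρ ε ι * (lam * t) := by gcongr
  linarith

lemma IsSmoothWith.continuous_gradient (hF : IsSmoothWith F lam) (hlam : 0 < lam) :
    Continuous (gradient F) :=
  (hF.lipschitzWith_gradient hlam).continuous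

lemma IsSmoothWith.continuous_step (hF : IsSmoothWith F lam) (hlam : 0 < lam)
    (hS : ∀ x, S x = x - lam • gradient F x) : Continuous S := by
  rw [show S = fun x => x - lam • gradient F x from funext hS]
  have := hF.continuous_gradient hlam
  fun_prop

lemma isOpen_stuck (hlam : 0 < lam) (hF : IsSmoothWith F lam)
    (hS : ∀ x, S x = x - lam • gradient F x) :
    IsOpen {p : Eu d × Eu d | p.2 ∈ stuck F S lam ρ ε ι p.1} := by
  have h1 : Continuous F := hF.differentiable.continuous
  have h2 := (hF.continuous_step hlam hS).iterate (windowLength lam ρ ε ι)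
  exact isOpen_lt (by fun_prop) (h1.comp (h2.comp (by fun_prop)))

/-- The perturbations that do not escape from a strict saddle point have small volume. -/
lemma volume_stuck_le (hd : 0 < d) (h : Admissible lam ρ ε ι) (hF : IsSmoothWith F lam)
    (hS : ∀ x, S x = x - lam • gradient F x)
    (hH : HessianLipschitzNearCritical F ρ ε (locRadius ρ ε ι)) {x : Eu d}
    (hx : ‖gradient F x‖ ≤ ε) (hmin : lambdaMin (hessian F x) ≤ -(√(ρ * ε) / 2))
    {Δ δ : ℝ} {N : ℕ} (hN0 : 0 < N) (hΔ : decrease ρ ε ι ≤ Δ) (hδ0 : 0 < δ)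
    (hδ1 : δ < 1) (hι : (10 : ℝ) ^ 30 ≤ ι)
    (hlog : (10 : ℝ) ^ 30 * Real.log (d * Δ / (lam * ε ^ 2 * δ)) ≤ ι)
    (hN : (N : ℝ) ≤ numIter lam ρ ε ι Δ + 1) :
    volume (stuck F S lam ρ ε ι x ∩ Metric.closedBall 0 (pertRadius ε ι)) ≤
      ENNReal.ofReal (δ / N) * volume (Metric.closedBall (0 : Eu d) (pertRadius ε ι)) := by
  have hl := h.lam_pos
  have hub := h.union_bound hd hΔ hδ0 hδ1 hι hlog hN
  set w := 4 * locRadius ρ ε ι / (lam * Real.exp (ι / 4)) with hw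
  have hw0 : 0 < w := by have := h.locRadius_pos; positivity
  obtain ⟨e, he, hAe⟩ := exists_lambdaMin_eigenvector hd
    (isSymmetric_hessian ((hH x hx).1 x (Metric.mem_ball_self h.locRadius_pos)))
  have hN' : (1 : ℝ) ≤ N := by exact_mod_cast hN0
  -- Chosen so that the fraction `3 / K` from `volume_thin_le` is at most `δ / N`; the rounding
  -- costs at most a factor 2, which explains the 6 in `union_bound`.
  set K := ⌈3 * N / δ⌉₊ with hK
  have hK1 : 3 * N / δ ≤ K := Nat.le_ceil _
  have hK2 : (K : ℝ) ≤ 6 * N / δ := by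
    have h1 : (K : ℝ) < 3 * N / δ + 1 := Nat.ceil_lt_add_one (by positivity)
    have h2 : 1 ≤ 3 * N / δ := by rw [le_div_iff₀ hδ0]; linarith
    have h3 : 6 * N / δ = 3 * N / δ + 3 * N / δ := by ring
    linarith
  have hmeas : MeasurableSet (stuck F S lam ρ ε ι x ∩ Metric.closedBall 0 (pertRadius ε ι)) := by
    refine MeasurableSet.inter ?_ measurableSet_closedBall
    exact ((isOpen_stuck (ρ := ρ) (ε := ε) (ι := ι) hl hF hS).preimage
      (Continuous.prodMk_right x)).measurableSet
  have hvol := volume_thin_le hd hmeas h.pertRadius_pos hw0 Set.inter_subset_right he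
    (K := K) (fun v hv v' hv' k hk => ?_) ?_
  · have hKpos : 0 < (K : ℝ) := lt_of_lt_of_le (by positivity) hK1
    have h3 : volume (stuck F S lam ρ ε ι x ∩ Metric.closedBall 0 (pertRadius ε ι)) ≤
        ENNReal.ofReal (3 / K) * volume (Metric.closedBall (0 : Eu d) (pertRadius ε ι)) := by
      rw [ENNReal.ofReal_div_of_pos hKpos, ENNReal.ofReal_natCast, ENNReal.ofReal_ofNat,
        ← ENNReal.mul_div_right_comm,
        ENNReal.le_div_iff_mul_le (Or.inl (by exact_mod_cast hKpos.ne')) (Or.inl (by simp)),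
        mul_comm]
      exact hvol
    refine h3.trans ?_
    gcongr ENNReal.ofReal ?_ * _
    rw [div_le_div_iff₀ hKpos (by positivity), mul_comm δ]
    rwa [div_le_iff₀ hδ0] at hK1
  · have hk1 : (1 : ℝ) ≤ k := by exact_mod_cast hk
    exact sub_ne_of_mem_stuck h hF hS hH hx hmin he hAe hv.1 hv'.1
      (mem_closedBall_zero_iff.1 hv.2) (mem_closedBall_zero_iff.1 hv'.2) (by rw [← hw]; nlinarith)
  · refine le_trans ?_ hub
    gcongr

end Escape

/-! ### Counting bad rounds -/

section Counting

lemma mul_card_large_le {Ψ : ℕ → ℝ} {large : ℕ → Prop} [DecidablePred large] {β : ℝ}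
    (hstep : ∀ n, Ψ (n + 1) ≤ Ψ n) (hlarge : ∀ n, large n → Ψ (n + 1) ≤ Ψ n - β) (n k : ℕ) :
    β * (((Finset.Ico n (n + k)).filter large).card : ℝ) ≤ Ψ n - Ψ (n + k) := by
  induction k with
  | zero => simp
  | succ k ih =>
    rw [← add_assoc, Nat.Ico_succ_right_eq_insert_Ico (by omega), Finset.filter_insert]
    split_ifs with hl
    · rw [Finset.card_insert_of_notMem (by simp)]
      push_cast
      linarith [hlarge _ hl]
    · linarith [hstep (n + k)]

/-- If the rounds split into blocks such that in each block all bad rounds decrease the potential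
by `β`, or the whole block decreases it by `β` times its length, then there are few bad rounds. -/
lemma mul_card_bad_le {Ψ : ℕ → ℝ} {large bad free : ℕ → Prop} [DecidablePred bad]
    {β L : ℝ} {N : ℕ} (hβ : 0 ≤ β)
    (hstep : ∀ n, Ψ (n + 1) ≤ Ψ n) (hlarge : ∀ n, large n → Ψ (n + 1) ≤ Ψ n - β)
    (hlow : ∀ n ≤ N, L ≤ Ψ n)
    (hblock : ∀ n < N, free n → ∃ k, 0 < k ∧ free (n + k) ∧
      ((∀ j < k, n + j < N → bad (n + j) → large (n + j)) ∨
        (Ψ (n + k) ≤ Ψ n - β * k ∧ L ≤ Ψ n - β * k)))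
    (n : ℕ) (hn : n ≤ N) (hfree : free n) :
    β * (((Finset.Ico n N).filter bad).card : ℝ) ≤ Ψ n - L := by
  classical
  induction hl : N - n using Nat.strong_induction_on generalizing n with
  | _ l ih =>
  rcases hn.eq_or_lt with rfl | hn
  · simpa using hlow _ le_rfl
  obtain ⟨k, hk, hfk, hcase⟩ := hblock n hn hfree
  rcases le_or_gt (n + k) N with hkN | hkN
  · have hrec := ih (N - (n + k)) (by omega) (n + k) hkN hfk rfl
    have hsplit : (((Finset.Ico n N).filter bad).card : ℝ) ≤
        ((Finset.Ico n (n + k)).filter bad).card + ((Finset.Ico (n + k) N).filter bad).card := by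
      rw [← Finset.Ico_union_Ico_eq_Ico (Nat.le_add_right n k) hkN, Finset.filter_union]
      exact_mod_cast Finset.card_union_le _ _
    have hfirst : β * (((Finset.Ico n (n + k)).filter bad).card : ℝ) ≤ Ψ n - Ψ (n + k) := by
      rcases hcase with h | ⟨h, -⟩
      · refine le_trans ?_ (mul_card_large_le hstep hlarge n k)
        refine mul_le_mul_of_nonneg_left (Nat.cast_le.2 (Finset.card_le_card fun t ht => ?_)) hβ
        simp only [Finset.mem_filter, Finset.mem_Ico] at ht ⊢
        obtain ⟨j, rfl⟩ := Nat.exists_eq_add_of_le ht.1.1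
        exact ⟨ht.1, h j (by omega) (by omega) ht.2⟩
      · have : (((Finset.Ico n (n + k)).filter bad).card : ℝ) ≤ k := by
          have := Finset.card_filter_le (Finset.Ico n (n + k)) bad
          simp only [Nat.card_Ico, Nat.add_sub_cancel_left] at this
          exact_mod_cast this
        nlinarith
    nlinarith
  · obtain ⟨l', rfl⟩ := Nat.exists_eq_add_of_lt hn
    -- The last block runs past `N`, where `Ψ` has no known lower bound; hence the separate
    -- requirement `L ≤ Ψ n - β * k`.
    rcases hcase with h | ⟨-, h⟩
    · refine le_trans ?_ ((mul_card_large_le hstep hlarge n (l' + 1)).trans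
        (sub_le_sub_left (hlow _ le_rfl) _))
      refine mul_le_mul_of_nonneg_left (Nat.cast_le.2 (Finset.card_le_card fun t ht => ?_)) hβ
      simp only [Finset.mem_filter, Finset.mem_Ico] at ht ⊢
      obtain ⟨j, rfl⟩ := Nat.exists_eq_add_of_le ht.1.1
      exact ⟨by omega, h j (by omega) (by omega) ht.2⟩
    · have : (((Finset.Ico n (n + l' + 1)).filter bad).card : ℝ) ≤ k := by
        have := Finset.card_filter_le (Finset.Ico n (n + l' + 1)) bad
        simp only [Nat.card_Ico] at this
        exact_mod_cast (by omega)
      nlinarith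

/-- The same with an initial block in which the bad rounds may be left uncompensated. -/
lemma mul_card_bad_le_of_initial {Ψ : ℕ → ℝ} {large bad free : ℕ → Prop} [DecidablePred bad]
    {β L : ℝ} {N m : ℕ}
    (hβ : 0 ≤ β)
    (hstep : ∀ n, Ψ (n + 1) ≤ Ψ n) (hlarge : ∀ n, large n → Ψ (n + 1) ≤ Ψ n - β)
    (hlow : ∀ n ≤ N, L ≤ Ψ n)
    (hblock : ∀ n < N, free n → ∃ k, 0 < k ∧ free (n + k) ∧
      ((∀ j < k, n + j < N → bad (n + j) → large (n + j)) ∨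
        (Ψ (n + k) ≤ Ψ n - β * k ∧ L ≤ Ψ n - β * k)))
    (hm : free m) :
    β * (((Finset.range N).filter bad).card : ℝ) ≤ Ψ 0 - L ∨
      ((∃ j < m, j < N ∧ bad j ∧ ¬ large j) ∧
        β * (((Finset.range N).filter bad).card : ℝ) ≤ Ψ 0 - L + β * m) := by
  classical
  have hanti : Antitone Ψ := antitone_nat_of_succ_le hstep
  have hinit : ∀ M ≤ m, M ≤ N → β * (((Finset.range M).filter bad).card : ℝ) ≤ Ψ 0 - Ψ M ∨
      ((∃ j < m, j < N ∧ bad j ∧ ¬ large j) ∧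
        β * (((Finset.range M).filter bad).card : ℝ) ≤ Ψ 0 - Ψ M + β * m) := by
    intro M hMm hMN
    by_cases hex : ∃ j < m, j < N ∧ bad j ∧ ¬ large j
    · right
      refine ⟨hex, ?_⟩
      have : (((Finset.range M).filter bad).card : ℝ) ≤ m := by
        have := Finset.card_filter_le (Finset.range M) bad
        rw [Finset.card_range] at this
        exact_mod_cast this.trans hMm
      nlinarith [hanti (Nat.zero_le M)]
    · left
      push Not at hex
      have h1 := mul_card_large_le hstep hlarge 0 M
      rw [zero_add, ← Finset.range_eq_Ico] at h1
      refine le_trans ?_ h1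
      refine mul_le_mul_of_nonneg_left (Nat.cast_le.2 (Finset.card_le_card fun t ht => ?_)) hβ
      simp only [Finset.mem_filter, Finset.mem_range] at ht ⊢
      exact ⟨ht.1, hex t (by omega) (by omega) ht.2⟩
  rcases le_or_gt N m with hNm | hNm
  · rcases hinit N hNm le_rfl with h | ⟨h, h'⟩
    · left; linarith [hlow N le_rfl]
    · right; exact ⟨h, by linarith [hlow N le_rfl]⟩
  · have h1 := mul_card_bad_le hβ hstep hlarge hlow hblock m hNm.le hm
    have hsplit : (((Finset.range N).filter bad).card : ℝ) ≤
        ((Finset.range m).filter bad).card + ((Finset.Ico m N).filter bad).card := by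
      rw [Finset.range_eq_Ico, Finset.range_eq_Ico,
        ← Finset.Ico_union_Ico_eq_Ico (Nat.zero_le m) hNm.le, Finset.filter_union]
      exact_mod_cast Finset.card_union_le _ _
    have hsplit' := mul_le_mul_of_nonneg_left hsplit hβ
    rw [mul_add] at hsplit'
    rcases hinit m le_rfl hNm.le with h | ⟨h, h'⟩
    · left; linarith
    · right; exact ⟨h, by linarith⟩

end Counting

/-! ### The trajectory -/

section Trajectory

variable {d : ℕ} {F : Eu d → ℝ} {S g : Eu d → Eu d} {lam ρ ε ι η τ : ℝ} {x₀ : Eu d}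
  {ξ : ℕ → Eu d}

lemma perturb_of_not {v : Eu d} {t : ℕ} {s : Eu d × ℕ}
    (h : ¬ (‖g s.1‖ ≤ ε ∧ τ < (t : ℝ) - (s.2 : ℝ))) : perturb g η τ ε v t s = s := if_neg h

lemma perturb_of {v : Eu d} {t : ℕ} {s : Eu d × ℕ}
    (h : ‖g s.1‖ ≤ ε ∧ τ < (t : ℝ) - (s.2 : ℝ)) :
    perturb g η τ ε v t s = (s.1 - η • v, t) := if_pos h

lemma state_succ (n : ℕ) : state S g η τ ε x₀ ξ (n + 1) =
    (S (perturb g η τ ε (ξ n) n (state S g η τ ε x₀ ξ n)).1,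
      (perturb g η τ ε (ξ n) n (state S g η τ ε x₀ ξ n)).2) := rfl

lemma state_succ_snd_le (n : ℕ) : (state S g η τ ε x₀ ξ (n + 1)).2 ≤ n := by
  induction n with
  | zero =>
    rw [state_succ]
    by_cases h : ‖g (state S g η τ ε x₀ ξ 0).1‖ ≤ ε ∧
      τ < ((0 : ℕ) : ℝ) - ((state S g η τ ε x₀ ξ 0).2 : ℝ)
    · rw [perturb_of h]
    · rw [perturb_of_not h]; rfl
  | succ n ih =>
    rw [state_succ]
    by_cases h : ‖g (state S g η τ ε x₀ ξ (n + 1)).1‖ ≤ ε ∧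
      τ < ((n + 1 : ℕ) : ℝ) - ((state S g η τ ε x₀ ξ (n + 1)).2 : ℝ)
    · rw [perturb_of h]
    · rw [perturb_of_not h]; exact ih.trans (Nat.le_succ n)

/-- Within a window no perturbation takes place. -/
lemma state_add_eq {n s : ℕ} {y : Eu d}
    (h : state S g η τ ε x₀ ξ n = (y, s)) (j : ℕ) (hj : n + j ≤ s + (⌊τ⌋₊ + 1)) (hτ : 0 ≤ τ) :
    state S g η τ ε x₀ ξ (n + j) = (S^[j] y, s) := by
  induction j with
  | zero => simpa using h
  | succ j ih =>
    specialize ih (by omega)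
    -- Round `n + j` precedes `s + ⌊τ⌋₊ + 1`, the first round in which the waiting condition can
    -- hold. The state at the end of the window is taken before the perturbation of that round.
    rw [← add_assoc, state_succ, ih, perturb_of_not, Function.iterate_succ_apply']
    rintro ⟨-, h2⟩
    have h3 : ((n + j : ℕ) : ℝ) ≤ ((s + ⌊τ⌋₊ : ℕ) : ℝ) := by exact_mod_cast (by omega)
    push_cast at h3 h2
    linarith [Nat.floor_le hτ]

lemma iteratePost_eq_of_window {n s : ℕ} {y : Eu d}
    (h : state S g η τ ε x₀ ξ n = (y, s)) (hn : n < s + (⌊τ⌋₊ + 1)) (hτ : 0 ≤ τ) :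
    iteratePost S g η τ ε x₀ ξ n = y := by
  rw [iteratePost, h, perturb_of_not]
  rintro ⟨-, h2⟩
  have h3 : (n : ℝ) ≤ ((s + ⌊τ⌋₊ : ℕ) : ℝ) := by exact_mod_cast (by omega)
  push_cast at h3
  simp only at h2
  linarith [Nat.floor_le hτ]

/-- The function value, corrected by the total effect of the perturbations. -/
def potential (F : Eu d → ℝ) (lam ρ ε ι : ℝ) (s : Eu d × ℕ) : ℝ :=
  F s.1 - 2 * lam * pertRadius ε ι ^ 2 / windowLength lam ρ ε ι * s.2

/-- The descent step that follows the perturbation absorbs its first-order effect: `r * G ≤ (r² +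
G²) / 2`. The remaining increase is quadratic in `r`; a bound of order `lam * r * ε` could add up to
order `lam * √(ρ * ε) * Δ`, which need not be negligible. -/
lemma perturb_step_le (h : Admissible lam ρ ε ι) (hF : IsSmoothWith F lam)
    (hS : ∀ x, S x = x - lam • gradient F x) {x v : Eu d} (hx : ‖gradient F x‖ ≤ ε)
    (hv : ‖v‖ ≤ pertRadius ε ι) :
    F (S (x - lam • v)) ≤ F x + 2 * lam * pertRadius ε ι ^ 2 ∧
      (ε < ‖gradient F (x - lam • v)‖ → F (S (x - lam • v)) ≤ F x - 49 / 100 * lam * ε ^ 2) := by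
  have hl := h.lam_pos; have hε := h.eps_pos; have hr0 := h.pertRadius_pos
  have hr := h.pertRadius_le
  set r := pertRadius ε ι
  have h1 := hF.descent hl hS (x - lam • v)
  have h2 := hF.perturb_le hl x v
  have h3 := hF.norm_gradient_sub_le x (x - lam • v)
  rw [sub_sub_cancel, norm_smul, Real.norm_of_nonneg hl.le] at h3
  have h3' := le_of_mul_le_mul_left h3 hl
  have h4 : ‖gradient F x‖ ≤ ‖gradient F (x - lam • v)‖ + r := by
    have := norm_le_norm_add_norm_sub' (gradient F x) (gradient F (x - lam • v))
    linarith
  set G := ‖gradient F (x - lam • v)‖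
  have hv2 : ‖v‖ ^ 2 ≤ r ^ 2 := by gcongr
  have h5 : lam / 2 * ‖v‖ ^ 2 ≤ lam / 2 * r ^ 2 := by gcongr
  constructor
  · have h6 : lam * ‖v‖ * ‖gradient F x‖ ≤ lam * r * (G + r) := by gcongr
    nlinarith [mul_nonneg hl.le (sq_nonneg (G - r))]
  · intro hG
    have h6 : lam * ‖v‖ * ‖gradient F x‖ ≤ lam * (ε / 400) * ε := by
      gcongr; exact hv.trans hr
    have h7 : lam / 2 * r ^ 2 ≤ lam / 2 * (ε / 400) ^ 2 := by gcongr
    have h8 : lam / 2 * ε ^ 2 ≤ lam / 2 * G ^ 2 := by gcongr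
    have h9 : 0 < lam * ε ^ 2 := by positivity
    nlinarith

/-- A perturbation may raise `F` by `2 * lam * r²`, but it advances the last perturbation time by at
least the window length, which lowers the potential by the same amount. The gradient before a
perturbation is at most `ε`, so only the one after it can be large. -/
lemma potential_step (h : Admissible lam ρ ε ι) (hF : IsSmoothWith F lam)
    (hS : ∀ x, S x = x - lam • gradient F x) (hξ : ∀ n, ‖ξ n‖ ≤ pertRadius ε ι) (n : ℕ) :
    potential F lam ρ ε ι
        (state S (gradient F) lam (pertInterval lam ρ ε ι) ε x₀ ξ (n + 1)) ≤
      potential F lam ρ ε ι (state S (gradient F) lam (pertInterval lam ρ ε ι) ε x₀ ξ n) ∧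
    ((ε < ‖gradient F (iterate S (gradient F) lam (pertInterval lam ρ ε ι) ε x₀ ξ n)‖ ∨
      ε < ‖gradient F (iteratePost S (gradient F) lam (pertInterval lam ρ ε ι) ε x₀ ξ n)‖) →
      potential F lam ρ ε ι
        (state S (gradient F) lam (pertInterval lam ρ ε ι) ε x₀ ξ (n + 1)) ≤
      potential F lam ρ ε ι (state S (gradient F) lam (pertInterval lam ρ ε ι) ε x₀ ξ n) -
        49 / 100 * lam * ε ^ 2) := by
  have hl := h.lam_pos; have hε := h.eps_pos; have hr0 := h.pertRadius_pos
  rw [state_succ, iterate, iteratePost]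
  obtain ⟨x, s⟩ := state S (gradient F) lam (pertInterval lam ρ ε ι) ε x₀ ξ n
  have hm0 : (0 : ℝ) < windowLength lam ρ ε ι := by exact_mod_cast Nat.succ_pos _
  by_cases hp : ‖gradient F x‖ ≤ ε ∧ pertInterval lam ρ ε ι < (n : ℝ) - (s : ℝ)
  · rw [perturb_of (s := (x, s)) hp]
    obtain ⟨h1, h2⟩ := perturb_step_le h hF hS hp.1 (hξ n)
    simp only [potential]
    have h3 : (s : ℝ) + windowLength lam ρ ε ι ≤ n := by
      have h4 : pertInterval lam ρ ε ι < ((n - s : ℕ) : ℝ) := by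
        rw [Nat.cast_sub]
        · exact hp.2
        · have := h.pertInterval_ge
          have h5 : (s : ℝ) < n := by linarith [hp.2]
          exact_mod_cast h5.le
      have h5 : ⌊pertInterval lam ρ ε ι⌋₊ < n - s :=
        (Nat.floor_lt (by linarith [h.pertInterval_ge])).2 h4
      have h6 : s + windowLength lam ρ ε ι ≤ n := by unfold windowLength; omega
      exact_mod_cast h6
    have h4 : 2 * lam * pertRadius ε ι ^ 2 / windowLength lam ρ ε ι * s +
        2 * lam * pertRadius ε ι ^ 2 ≤ 2 * lam * pertRadius ε ι ^ 2 / windowLength lam ρ ε ι * n := by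
      have e : 2 * lam * pertRadius ε ι ^ 2 / windowLength lam ρ ε ι * s +
          2 * lam * pertRadius ε ι ^ 2 =
          2 * lam * pertRadius ε ι ^ 2 / windowLength lam ρ ε ι *
            (s + windowLength lam ρ ε ι) := by field_simp
      rw [e]; gcongr
    have h5 : 0 ≤ 2 * lam * pertRadius ε ι ^ 2 := by positivity
    refine ⟨by linarith, ?_⟩
    rintro (h6 | h6)
    · exact absurd hp.1 (not_le.2 h6)
    · linarith [h2 h6]
  · rw [perturb_of_not (s := (x, s)) hp]
    have h1 := hF.descent hl hS x
    simp only [potential, or_self]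
    have h2 : 0 ≤ lam / 2 * ‖gradient F x‖ ^ 2 := by positivity
    refine ⟨by linarith, fun h3 => ?_⟩
    have h4 : lam / 2 * ε ^ 2 ≤ lam / 2 * ‖gradient F x‖ ^ 2 := by gcongr
    have h5 : 0 < lam * ε ^ 2 := by positivity
    linarith

/-- `x` is an approximate critical point without strongly negative curvature. -/
def Settled (F : Eu d → ℝ) (ρ ε : ℝ) (x : Eu d) : Prop :=
  ‖gradient F x‖ ≤ ε ∧ -√(ρ * ε) < lambdaMin (hessian F x)

open scoped Classical in
/-- The deterministic part of the analysis: if every perturbation at a strict saddle point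
succeeds, then at most half of the rounds are bad. -/
lemma card_not_settled_le (hd : 0 < d) (h : Admissible lam ρ ε ι) (hF : IsSmoothWith F lam)
    (hS : ∀ x, S x = x - lam • gradient F x)
    (hH : HessianLipschitzNearCritical F ρ ε (locRadius ρ ε ι))
    (hbdd : BddBelow (Set.range F)) {N : ℕ}
    (hN : N = ⌈numIter lam ρ ε ι (gap F x₀)⌉₊)
    (hξ : ∀ n, ‖ξ n‖ ≤ pertRadius ε ι)
    (hgood : ∀ n < N, ∀ x,
      x = iterate S (gradient F) lam (pertInterval lam ρ ε ι) ε x₀ ξ n →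
      ‖gradient F x‖ ≤ ε → lambdaMin (hessian F x) ≤ -(√(ρ * ε) / 2) →
      decrease ρ ε ι ≤ gap F x₀ → ξ n ∉ stuck F S lam ρ ε ι x) :
    (((Finset.range N).filter fun n =>
      ¬ (Settled F ρ ε (iterate S (gradient F) lam (pertInterval lam ρ ε ι) ε x₀ ξ n) ∧
        Settled F ρ ε (iteratePost S (gradient F) lam (pertInterval lam ρ ε ι) ε x₀ ξ n))).card : ℝ)
      ≤ N / 2 := by
  have hl := h.lam_pos; have hε := h.eps_pos; have hr0 := h.pertRadius_pos
  have hq := h.sqrt_pos; have hι0 := h.iota_pos; have hι := h.le_iota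
  set τ := pertInterval lam ρ ε ι with hτ
  have hτ0 : 0 ≤ τ := by linarith [h.pertInterval_ge]
  set m := windowLength lam ρ ε ι with hm
  have hm' : m = ⌊τ⌋₊ + 1 := rfl
  have hm0 : (0 : ℝ) < m := by exact_mod_cast Nat.succ_pos _
  set st := state S (gradient F) lam τ ε x₀ ξ with hst
  set X := iterate S (gradient F) lam τ ε x₀ ξ with hX
  set Y := iteratePost S (gradient F) lam τ ε x₀ ξ with hY
  set Δ := gap F x₀ with hΔ
  set inf := ⨅ x, F x with hinf
  have hinf_le : ∀ x, inf ≤ F x := fun x => ciInf_le hbdd x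
  have hΔ' : F x₀ = inf + Δ := by rw [hΔ, gap]; ring
  have hΔ0 : 0 ≤ Δ := by linarith [hinf_le x₀]
  set T := numIter lam ρ ε ι Δ with hT
  have hT' : T = 400 * ι ^ 4 * (Δ / (lam * ε ^ 2)) := h.numIter_eq hΔ0
  have hT0 : 0 ≤ T := by rw [hT']; positivity
  have hTN : T ≤ N := by rw [hN]; exact Nat.le_ceil _
  have hNT : ∀ n < N, (n : ℝ) < T := fun n hn => Nat.lt_ceil.1 (hN ▸ hn)
  set u := lam * √(ρ * ε) with hu
  have hu0 : 0 < u := mul_pos hl hq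
  have hu1 : u < 1 := h.lam_mul_sqrt_lt_one
  set Ψ : ℕ → ℝ := fun n => potential F lam ρ ε ι (st n) with hΨ
  set large : ℕ → Prop := fun n => ε < ‖gradient F (X n)‖ ∨ ε < ‖gradient F (Y n)‖ with hlarge
  set bad : ℕ → Prop := fun n => ¬ (Settled F ρ ε (X n) ∧ Settled F ρ ε (Y n)) with hbad
  set free : ℕ → Prop := fun n => τ < (n : ℝ) - ((st n).2 : ℝ) with hfree
  -- Small enough that a whole window costs at most `decrease / 2`, large enough that the budget
  -- `1.01 * Δ` covers at most `10201 / 40000 * T` bad rounds.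
  set β := lam * ε ^ 2 / (101 * ι ^ 4) with hβ
  have hβ0 : 0 < β := by positivity
  have hβε : β ≤ 49 / 100 * lam * ε ^ 2 := by
    rw [hβ, div_le_iff₀ (by positivity)]
    have h1 : 1 ≤ ι ^ 4 := one_le_pow₀ (by linarith)
    have h2 : 0 < lam * ε ^ 2 := by positivity
    nlinarith
  have hβm : β * m ≤ decrease ρ ε ι / 2 := by
    have e : decrease ρ ε ι / 2 = β * (101 / 100 * (ι / u)) := by
      rw [h.decrease_eq, hβ, hu]
      generalize √(ρ * ε) = q at hq
      field_simp
      norm_num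
    rw [e]
    gcongr
    refine h.windowLength_le.trans ?_
    rw [← hu]
    have : 0 < ι / u := by positivity
    linarith
  have hstep : ∀ n, Ψ (n + 1) ≤ Ψ n := fun n => (potential_step h hF hS hξ n).1
  have hstepL : ∀ n, large n → Ψ (n + 1) ≤ Ψ n - β := fun n hn =>
    ((potential_step h hF hS hξ n).2 hn).trans (by linarith)
  have hanti : Antitone Ψ := antitone_nat_of_succ_le hstep
  have hΨ0 : Ψ 0 = inf + Δ := by
    simp only [hΨ, hst, potential, state]; rw [← hΔ']; simp
  -- the total effect of the perturbations is negligible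
  have hcorr : ∀ n ≤ N, 2 * lam * pertRadius ε ι ^ 2 / m * (st n).2 ≤ Δ / 100 := by
    intro n hn
    have h1 : ((st n).2 : ℝ) ≤ T := by
      rcases n with _ | n
      · simpa [hst, state] using hT0
      · refine le_trans ?_ (hNT n (by omega)).le
        exact_mod_cast state_succ_snd_le n
    have h2 := h.iota_lt_windowLength_mul
    rw [← hm, ← hu] at h2
    calc 2 * lam * pertRadius ε ι ^ 2 / m * (st n).2 ≤ 2 * lam * pertRadius ε ι ^ 2 / m * T := by
          gcongr
      _ = Δ * (1 / (200 * (ι ^ 2 * m))) := by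
        rw [hT', pertRadius]; field_simp; ring
      _ ≤ Δ * (1 / 100) := by
        gcongr
        have h3 : (1 : ℝ) ≤ m := by exact_mod_cast Nat.succ_pos _
        have h4 : (1 : ℝ) ≤ ι ^ 2 := one_le_pow₀ (by linarith)
        nlinarith
      _ = Δ / 100 := by ring
  set L := inf - Δ / 100 with hL
  have hΨF : ∀ n, Ψ n = F (X n) - 2 * lam * pertRadius ε ι ^ 2 / m * (st n).2 := fun n => rfl
  have hlow : ∀ n ≤ N, L ≤ Ψ n := by
    intro n hn
    rw [hΨF]
    linarith [hcorr n hn, hinf_le (X n)]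
  -- a visited saddle point forces a large gap
  have hgap : ∀ n ≤ N, ‖gradient F (X n)‖ ≤ ε →
      lambdaMin (hessian F (X n)) ≤ -(√(ρ * ε) / 2) → decrease ρ ε ι ≤ Δ := by
    intro n hn h1 h2
    obtain ⟨y, hy⟩ := exists_le_sub_decrease hd h hF hH h1 h2
    have h3 := hanti (Nat.zero_le n)
    rw [hΨ0, hΨF] at h3
    linarith [hcorr n hn, hinf_le y, h.decrease_pos]
  have hblock : ∀ n < N, free n → ∃ k, 0 < k ∧ free (n + k) ∧
      ((∀ j < k, n + j < N → bad (n + j) → large (n + j)) ∨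
        (Ψ (n + k) ≤ Ψ n - β * k ∧ L ≤ Ψ n - β * k)) := by
    intro n hn hfr
    by_cases hgr : ‖gradient F (X n)‖ ≤ ε
    · have hst1 : st (n + 1) = (S (X n - lam • ξ n), n) := by
        rw [hst, state_succ, perturb_of (s := state S (gradient F) lam τ ε x₀ ξ n) ⟨hgr, hfr⟩]
        rfl
      have hYn : Y n = X n - lam • ξ n := by
        rw [hY, iteratePost, perturb_of (s := state S (gradient F) lam τ ε x₀ ξ n) ⟨hgr, hfr⟩]
        rfl
      have hstj : ∀ j, 0 < j → j ≤ m → st (n + j) = (S^[j] (X n - lam • ξ n), n) := by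
        intro j hj hjm
        obtain ⟨j, rfl⟩ : ∃ i, j = i + 1 := ⟨j - 1, by omega⟩
        have := state_add_eq hst1 j (by omega) hτ0
        rw [Function.iterate_succ_apply, ← this, hst]
        congr 1
        omega
      have hXj : ∀ j, 0 < j → j ≤ m → X (n + j) = S^[j] (X n - lam • ξ n) := by
        intro j hj hjm
        rw [hX, iterate, ← hst, hstj j hj hjm]
      have hYj : ∀ j < m, Y (n + j) = S^[j] (X n - lam • ξ n) := by
        intro j hjm
        rcases Nat.eq_zero_or_pos j with rfl | hj
        · simpa using hYn
        · exact iteratePost_eq_of_window (hstj j hj hjm.le) (by omega) hτ0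
      have hm1 : 0 < m := Nat.succ_pos _
      refine ⟨m, hm1, ?_, ?_⟩
      · simp only [hfree, hstj m hm1 le_rfl]
        push_cast
        rw [add_sub_cancel_left]
        exact lt_windowLength lam ρ ε ι
      · by_cases hall : ∀ j < m, n + j < N → bad (n + j) → large (n + j)
        · exact Or.inl hall
        right
        push Not at hall
        obtain ⟨j, hjm, hjN, hbj, hlj⟩ := hall
        -- A drop by half of `decrease` pays `β` for every round of the window. Since `n + m` may
        -- exceed `N`, the bound against `L` uses the correction at time `n` only.
        suffices hdrop : F (X (n + m)) ≤ F (X n) - decrease ρ ε ι / 2 by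
          have h2 : ((st n).2 : ℝ) ≤ n := by
            rcases n with _ | n
            · simp [hst, state]
            · exact_mod_cast (state_succ_snd_le n).trans (Nat.le_succ n)
          have h3 : 2 * lam * pertRadius ε ι ^ 2 / m * (st n).2 ≤
            2 * lam * pertRadius ε ι ^ 2 / m * n := by gcongr
          constructor
          · rw [hΨF, hΨF, hstj m hm1 le_rfl]
            linarith
          · rw [hΨF]
            linarith [hcorr n hn.le, hinf_le (X (n + m))]
        have hXm := hXj m hm1 le_rfl
        have hsaddle : lambdaMin (hessian F (X n)) ≤ -√(ρ * ε) ∨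
            lambdaMin (hessian F (S^[j] (X n - lam • ξ n))) ≤ -√(ρ * ε) := by
          simp only [hlarge, not_or, not_lt] at hlj
          simp only [Settled, hlj.1, hlj.2, true_and, not_lt] at hbj
          rcases le_or_gt (lambdaMin (hessian F (X (n + j)))) (-√(ρ * ε)) with h1 | h1
          · rcases Nat.eq_zero_or_pos j with rfl | hj
            · exact Or.inl h1
            · exact Or.inr (hXj j hj hjm.le ▸ h1)
          · exact Or.inr (hYj j hjm ▸ hbj h1)
        rw [hXm]
        by_contra! hcon
        have hmem := iterate_mem_ball h hF hS hgr (hξ n) hjm.le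
          (hcon.le.trans (hF.antitone_iterate hl hS _ hjm.le))
        -- Within `locRadius` the smallest eigenvalue changes by at most `√(ρ ε) / (4 ι)`, so a
        -- saddle met later in the window shows at `X n`, with at least half of its curvature. This
        -- is why stuck perturbations are studied at the threshold `√(ρ ε) / 2`.
        have hsad : lambdaMin (hessian F (X n)) ≤ -(√(ρ * ε) / 2) := by
          rcases hsaddle with h1 | h1
          · linarith
          · have h2 := hH.lambdaMin_le hd h.rho_pos hgr hmem
            rw [h.rho_mul_locRadius] at h2
            have h3 : √(ρ * ε) / (4 * ι) ≤ √(ρ * ε) / 2 := by gcongr; linarith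
            linarith
        exact hgood n hn (X n) rfl hgr hsad (hgap n hn.le hgr hsad) hcon
    · refine ⟨1, one_pos, ?_, Or.inl ?_⟩
      · have : (st (n + 1)).2 = (st n).2 := by
          rw [hst, state_succ, perturb_of_not]
          exact fun h1 => hgr h1.1
        simp only [hfree, this]
        push_cast
        simp only [hfree] at hfr
        linarith
      · intro j hj _ _
        obtain rfl : j = 0 := by omega
        exact Or.inl (not_le.1 hgr)
  have hstw : ∀ j ≤ m, st j = (S^[j] x₀, 0) := by
    intro j hj
    have := state_add_eq (S := S) (g := gradient F) (η := lam) (τ := τ) (ε := ε) (ξ := ξ)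
      (n := 0) (s := 0) (y := x₀) rfl j (by omega) hτ0
    rwa [zero_add] at this
  have hfm : free m := by
    simp only [hfree, hstw m le_rfl]
    simpa using lt_windowLength lam ρ ε ι
  have hβT : (Δ + Δ / 100) = β * (10201 / 40000 * T) := by
    rw [hβ, hT']; field_simp; ring
  -- No perturbation happens in the first `m` rounds, so bad rounds there may go unpaid. But one
  -- such round is at a saddle, which forces `decrease ≤ Δ` and hence `m ≤ 1001 / 8000 * T`; the
  -- total stays below `T / 2`.
  rcases mul_card_bad_le_of_initial hβ0.le hstep hstepL hlow hblock hfm with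
    h1 | ⟨⟨j, hjm, hjN, hbj, hlj⟩, h1⟩
  · rw [hΨ0, hL] at h1
    refine (le_of_mul_le_mul_left (b := _) (c := 10201 / 40000 * T) (a := β)
      (h1.trans (by linarith)) hβ0).trans ?_
    linarith
  · have hXj : X j = S^[j] x₀ := by rw [hX, iterate, ← hst, hstw j hjm.le]
    have hYj : Y j = S^[j] x₀ := iteratePost_eq_of_window (hstw j hjm.le) (by omega) hτ0
    simp only [hlarge, not_or, not_lt] at hlj
    simp only [hbad, Settled, hlj.1, true_and, hYj, ← hXj, and_self, not_lt] at hbj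
    have h2 := h.windowLength_le_numIter (hgap j hjN.le hlj.1 (by linarith))
    rw [hΨ0, hL] at h1
    rw [← hm, ← hT] at h2
    refine (le_of_mul_le_mul_left (a := β) (c := 10201 / 40000 * T + m)
      (h1.trans (by linarith)) hβ0).trans ?_
    linarith

end Trajectory

open ProbabilityTheory

/-! ### The probability that all perturbations succeed -/

section Probability

variable {d : ℕ} {F : Eu d → ℝ} {S g : Eu d → Eu d} {lam ρ ε ι η τ : ℝ} {x₀ : Eu d}

lemma state_congr {ξ ξ' : ℕ → Eu d} (n : ℕ) (h : ∀ t < n, ξ t = ξ' t) :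
    state S g η τ ε x₀ ξ n = state S g η τ ε x₀ ξ' n := by
  induction n with
  | zero => rfl
  | succ n ih =>
    rw [state_succ, state_succ, ih fun t ht => h t (by omega), h n (by omega)]

lemma measurable_perturb (hg : Measurable g) (t : ℕ) :
    Measurable fun p : Eu d × (Eu d × ℕ) => perturb g η τ ε p.1 t p.2 := by
  unfold perturb
  refine Measurable.ite ?_ (by fun_prop) (by fun_prop)
  have h1 : Measurable fun p : Eu d × (Eu d × ℕ) => ‖g p.2.1‖ := by fun_prop
  have h2 : Measurable fun p : Eu d × (Eu d × ℕ) => (t : ℝ) - (p.2.2 : ℝ) := by fun_prop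
  exact (measurableSet_le h1 measurable_const).inter (measurableSet_lt measurable_const h2)

lemma measurable_state (hS : Measurable S) (hg : Measurable g) (n : ℕ) :
    Measurable fun ξ : ℕ → Eu d => state S g η τ ε x₀ ξ n := by
  induction n with
  | zero => exact measurable_const
  | succ n ih =>
    have h1 : Measurable fun ξ : ℕ → Eu d =>
        perturb g η τ ε (ξ n) n (state S g η τ ε x₀ ξ n) :=
      Measurable.comp (g := fun p : Eu d × (Eu d × ℕ) => perturb g η τ ε p.1 n p.2)
        (f := fun ξ : ℕ → Eu d => (ξ n, state S g η τ ε x₀ ξ n))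
        (measurable_perturb hg n) ((measurable_pi_apply n).prodMk ih)
    exact (hS.comp h1.fst).prodMk h1.snd

/-- The iterate of round `n` is independent of the noise of round `n`. -/
lemma indepFun_iterate {Ω : Type*} [MeasurableSpace Ω] {P : Measure Ω} [IsProbabilityMeasure P]
    {ξ : ℕ → Ω → Eu d} (hξm : ∀ t, Measurable (ξ t)) (hind : iIndepFun ξ P)
    (hS : Measurable S) (hg : Measurable g) (n : ℕ) :
    IndepFun (fun ω => iterate S g η τ ε x₀ (fun t => ξ t ω) n) (ξ n) P := by
  have h1 := hind.indepFun_finset (Finset.range n) {n} (by simp) hξm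
  -- The iterate of round `n` reads only earlier noise, so padding by zero does not change it.
  let ext : (Finset.range n → Eu d) → ℕ → Eu d :=
    fun z t => if ht : t ∈ Finset.range n then z ⟨t, ht⟩ else 0
  have hext : Measurable ext := by
    refine measurable_pi_iff.2 fun t => ?_
    by_cases ht : t ∈ Finset.range n
    · simp only [ext, ht, dite_true]; exact measurable_pi_apply _
    · simp only [ext, ht, dite_false]; exact measurable_const
  have h2 : Measurable fun z : Finset.range n → Eu d => (state S g η τ ε x₀ (ext z) n).1 :=
    ((measurable_state hS hg n).comp hext).fst
  have h3 : Measurable fun z : ({n} : Finset ℕ) → Eu d => z ⟨n, by simp⟩ := measurable_pi_apply _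
  have h4 := h1.comp h2 h3
  have e : (fun ω => iterate S g η τ ε x₀ (fun t => ξ t ω) n) =
      (fun z : Finset.range n → Eu d => (state S g η τ ε x₀ (ext z) n).1) ∘
        fun ω (i : Finset.range n) => ξ i ω := by
    funext ω
    simp only [Function.comp, iterate]
    rw [state_congr n]
    intro t ht
    simp [ext, ht]
  rw [e]
  exact h4

/-- If `v` avoids the `x`-section of a set with high probability for each `x` in question, then so
does an independent pair. -/
lemma prob_pair_mem_le {Ω E : Type*} [MeasurableSpace Ω] {P : Measure Ω} [IsProbabilityMeasure P]
    [MeasurableSpace E] {X V : Ω → E} (hX : Measurable X) (hV : Measurable V)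
    (hXV : IndepFun X V P) {B : Set (E × E)} (hB : MeasurableSet B) (c : ENNReal) :
    MeasurableSet {ω | P.map V (Prod.mk (X ω) ⁻¹' B) ≤ c ∧ (X ω, V ω) ∈ B} ∧
      P {ω | P.map V (Prod.mk (X ω) ⁻¹' B) ≤ c ∧ (X ω, V ω) ∈ B} ≤ c := by
  have := Measure.isProbabilityMeasure_map (μ := P) hV.aemeasurable
  have := Measure.isProbabilityMeasure_map (μ := P) hX.aemeasurable
  set A : Set E := {x | P.map V (Prod.mk x ⁻¹' B) ≤ c} with hA
  have hAm : MeasurableSet A :=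
    measurableSet_le (measurable_measure_prodMk_left hB) measurable_const
  set C : Set (E × E) := (A ×ˢ Set.univ) ∩ B with hC
  have hCm : MeasurableSet C := (hAm.prod MeasurableSet.univ).inter hB
  have e : {ω | P.map V (Prod.mk (X ω) ⁻¹' B) ≤ c ∧ (X ω, V ω) ∈ B} =
      (fun ω => (X ω, V ω)) ⁻¹' C := by
    ext ω; simp [hC, hA]
  rw [e]
  refine ⟨(hX.prodMk hV) hCm, ?_⟩
  rw [← Measure.map_apply (hX.prodMk hV) hCm,
    (indepFun_iff_map_prod_eq_prod_map_map hX.aemeasurable hV.aemeasurable).1 hXV,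
    Measure.prod_apply hCm]
  calc ∫⁻ x, P.map V (Prod.mk x ⁻¹' C) ∂(P.map X) ≤ ∫⁻ _, c ∂(P.map X) := by
        refine lintegral_mono fun x => ?_
        by_cases hx : x ∈ A
        · refine le_trans (measure_mono fun v hv => ?_) hx
          exact hv.2
        · have : Prod.mk x ⁻¹' C = ∅ := by
            ext v; simp [hC, hx]
          rw [this]; simp
    _ = c := by simp

lemma map_apply_of_isUniform {Ω : Type*} [MeasurableSpace Ω] {P : Measure Ω} {V : Ω → Eu d} {r : ℝ}
    (hU : pdf.IsUniform V (Metric.closedBall 0 r) P volume) (W : Set (Eu d)) :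
    P.map V W = (volume (Metric.closedBall (0 : Eu d) r))⁻¹ *
      volume (W ∩ Metric.closedBall 0 r) := by
  rw [hU, ProbabilityTheory.cond_apply measurableSet_closedBall, Set.inter_comm]

open scoped Classical in
lemma prob_half_settled {Ω : Type*} [MeasurableSpace Ω] {P : Measure Ω} [IsProbabilityMeasure P]
    (hd : 0 < d) (h : Admissible lam ρ ε ι) (hF : IsSmoothWith F lam)
    (hS : ∀ x, S x = x - lam • gradient F x)
    (hH : HessianLipschitzNearCritical F ρ ε (locRadius ρ ε ι))
    (hbdd : BddBelow (Set.range F)) {δ : ℝ} (hδ0 : 0 < δ) (hδ1 : δ < 1) (hι : (10 : ℝ) ^ 30 ≤ ι)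
    (hlog : (10 : ℝ) ^ 30 * Real.log (d * gap F x₀ / (lam * ε ^ 2 * δ)) ≤ ι) {N : ℕ}
    (hN : N = ⌈numIter lam ρ ε ι (gap F x₀)⌉₊) {ξ : ℕ → Ω → Eu d}
    (hξm : ∀ t, Measurable (ξ t)) (hind : iIndepFun ξ P)
    (hU : ∀ t, pdf.IsUniform (ξ t) (Metric.closedBall 0 (pertRadius ε ι)) P volume) :
    ENNReal.ofReal (1 - δ) ≤ P {ω | (((Finset.range N).filter fun n =>
      ¬ (Settled F ρ ε
          (iterate S (gradient F) lam (pertInterval lam ρ ε ι) ε x₀ (fun t => ξ t ω) n) ∧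
        Settled F ρ ε
          (iteratePost S (gradient F) lam (pertInterval lam ρ ε ι) ε x₀
            (fun t => ξ t ω) n))).card : ℝ)
      ≤ N / 2} := by
  have hl := h.lam_pos
  have hSm : Measurable S := (hF.continuous_step hl hS).measurable
  have hgm : Measurable (gradient F) := (hF.continuous_gradient hl).measurable
  set τ := pertInterval lam ρ ε ι
  set X : ℕ → Ω → Eu d := fun n ω => iterate S (gradient F) lam τ ε x₀ (fun t => ξ t ω) n with hX
  have hXm : ∀ n, Measurable (X n) := fun n =>
    ((measurable_state hSm hgm n).comp (measurable_pi_iff.2 hξm)).fst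
  set B : Set (Eu d × Eu d) := {p | p.2 ∈ stuck F S lam ρ ε ι p.1} with hB
  have hBm : MeasurableSet B := (isOpen_stuck hl hF hS).measurableSet
  set c := ENNReal.ofReal (δ / N) with hc
  -- Requiring the section to have small probability bounds `P (E n)` by `c` wherever the iterate
  -- lies; at saddle points `volume_stuck_le` supplies this requirement.
  set E : ℕ → Set Ω := fun n =>
    {ω | P.map (ξ n) (Prod.mk (X n ω) ⁻¹' B) ≤ c ∧ (X n ω, ξ n ω) ∈ B} with hE
  have hEp : ∀ n, MeasurableSet (E n) ∧ P (E n) ≤ c := fun n =>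
    prob_pair_mem_le (hXm n) (hξm n) (indepFun_iterate hξm hind hSm hgm n) hBm c
  set O : ℕ → Set Ω := fun n => ξ n ⁻¹' (Metric.closedBall 0 (pertRadius ε ι))ᶜ with hO
  have hOm : ∀ n, MeasurableSet (O n) := fun n => hξm n measurableSet_closedBall.compl
  have hO0 : ∀ n, P (O n) = 0 := fun n => by
    rw [hO, ← Measure.map_apply (hξm n) measurableSet_closedBall.compl,
      map_apply_of_isUniform (hU n)]
    simp
  set Z : Set Ω := (⋃ n ∈ Finset.range N, E n) ∪ ⋃ n, O n with hZ
  have hZm : MeasurableSet Z :=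
    (Finset.measurableSet_biUnion _ fun n _ => (hEp n).1).union (MeasurableSet.iUnion hOm)
  have hZp : P Z ≤ ENNReal.ofReal δ := by
    refine (measure_union_le _ _).trans ?_
    rw [measure_iUnion_null hO0, add_zero]
    refine (measure_biUnion_finset_le _ _).trans ?_
    refine (Finset.sum_le_sum fun n _ => (hEp n).2).trans ?_
    rw [Finset.sum_const, Finset.card_range, nsmul_eq_mul, hc]
    rcases Nat.eq_zero_or_pos N with h0 | h0
    · simp [h0]
    · rw [← ENNReal.ofReal_natCast, ← ENNReal.ofReal_mul (by positivity)]
      apply ENNReal.ofReal_le_ofReal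
      have : (0 : ℝ) < N := by exact_mod_cast h0
      rw [mul_div_cancel₀ _ this.ne']
  calc ENNReal.ofReal (1 - δ) = 1 - ENNReal.ofReal δ := by
        rw [ENNReal.ofReal_sub _ hδ0.le, ENNReal.ofReal_one]
    _ ≤ 1 - P Z := tsub_le_tsub_left hZp _
    _ = P Zᶜ := (prob_compl_eq_one_sub hZm).symm
    _ ≤ _ := measure_mono fun ω hω => ?_
  simp only [hZ, Set.mem_compl_iff, Set.mem_union, Set.mem_iUnion, Finset.mem_range, not_or,
    not_exists] at hω
  obtain ⟨hω1, hω2⟩ := hω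
  refine card_not_settled_le hd h hF hS hH hbdd hN (fun n => ?_) (fun n hn x hx hgx hmin hgap => ?_)
  · have := hω2 n
    simpa [hO] using this
  · have hnum : 0 ≤ numIter lam ρ ε ι (gap F x₀) := by
      rw [h.numIter_eq (h.decrease_pos.le.trans hgap)]
      have := h.decrease_pos.trans_le hgap
      have := h.iota_pos
      have := h.eps_pos
      positivity
    have hvol := volume_stuck_le hd h hF hS hH hgx hmin (by omega) hgap hδ0 hδ1 hι hlog
      (N := N) (by rw [hN]; exact (Nat.ceil_lt_add_one hnum).le)
    intro hst
    refine hω1 n hn ⟨?_, ?_⟩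
    · rw [map_apply_of_isUniform (hU n)]
      have e : Prod.mk (X n ω) ⁻¹' B = stuck F S lam ρ ε ι x := by rw [hx]; rfl
      rw [e]
      have hv0 : volume (Metric.closedBall (0 : Eu d) (pertRadius ε ι)) ≠ 0 :=
        (Metric.measure_closedBall_pos volume 0 h.pertRadius_pos).ne'
      have hv1 : volume (Metric.closedBall (0 : Eu d) (pertRadius ε ι)) ≠ ⊤ :=
        measure_closedBall_lt_top.ne
      calc (volume (Metric.closedBall (0 : Eu d) (pertRadius ε ι)))⁻¹ *
            volume (stuck F S lam ρ ε ι x ∩ Metric.closedBall 0 (pertRadius ε ι))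
          ≤ (volume (Metric.closedBall (0 : Eu d) (pertRadius ε ι)))⁻¹ *
            (c * volume (Metric.closedBall (0 : Eu d) (pertRadius ε ι))) := by gcongr
        _ = c * ((volume (Metric.closedBall (0 : Eu d) (pertRadius ε ι)))⁻¹ *
            volume (Metric.closedBall (0 : Eu d) (pertRadius ε ι))) := by ring
        _ = c := by rw [ENNReal.inv_mul_cancel hv0 hv1, mul_one]
    · rw [hx] at hst
      exact hst

end Probability

/-! ### From settled rounds to good rounds -/

open scoped Classical in
lemma halfGood_of_card_le {d : ℕ} (hd : 0 < d) {f : Eu d → EReal} {lam ρ ε ι : ℝ} {x₀ : Eu d}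
    {ξ : ℕ → Eu d} {N : ℕ}
    (hprox : ∀ x, prox f lam x = x - lam • gradient (moreau f lam) x)
    (h : Admissible lam ρ ε ι)
    (hH : HessianLipschitzNearCritical (moreau f lam) ρ ε (locRadius ρ ε ι))
    (hcard : (((Finset.range N).filter fun n =>
      ¬ (Settled (moreau f lam) ρ ε (iterate (prox f lam) (gradient (moreau f lam)) lam
            (pertInterval lam ρ ε ι) ε x₀ ξ n) ∧
        Settled (moreau f lam) ρ ε (iteratePost (prox f lam) (gradient (moreau f lam)) lam
            (pertInterval lam ρ ε ι) ε x₀ ξ n))).card : ℝ) ≤ N / 2) :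
    HalfGood f lam ρ ε ι x₀ ξ N := by
  have hgood : ∀ x, Settled (moreau f lam) ρ ε x → Good f lam ρ ε x := fun x hx =>
    good_of_lambdaMin hd hprox h.lam_pos h.locRadius_pos hH hx.1 hx.2
  set p : ℕ → Prop := fun n =>
    Settled (moreau f lam) ρ ε (iterate (prox f lam) (gradient (moreau f lam)) lam
            (pertInterval lam ρ ε ι) ε x₀ ξ n) ∧
        Settled (moreau f lam) ρ ε (iteratePost (prox f lam) (gradient (moreau f lam)) lam
            (pertInterval lam ρ ε ι) ε x₀ ξ n) with hp
  have hsum := Finset.card_filter_add_card_filter_not (s := Finset.range N) p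
  rw [Finset.card_range] at hsum
  have hsum' : (((Finset.range N).filter p).card : ℝ) +
      (((Finset.range N).filter fun n => ¬ p n).card : ℝ) = N := by exact_mod_cast hsum
  unfold HalfGood
  have hle : ((Finset.range N).filter p).card ≤ Set.ncard {t : ℕ | t < N ∧
    Good f lam ρ ε (iterate (prox f lam) (gradient (moreau f lam)) lam
      (pertInterval lam ρ ε ι) ε x₀ ξ t) ∧
    Good f lam ρ ε (iteratePost (prox f lam) (gradient (moreau f lam)) lam
      (pertInterval lam ρ ε ι) ε x₀ ξ t)} := by
    rw [← Set.ncard_coe_finset]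
    -- Finiteness of the larger set matters, since `Set.ncard` is zero on infinite sets.
    refine Set.ncard_le_ncard (fun t ht => ?_) ((Set.finite_lt_nat N).subset fun t ht => ht.1)
    simp only [Finset.coe_filter, Finset.mem_range] at ht
    exact ⟨ht.1, hgood _ ht.2.1, hgood _ ht.2.2⟩
  have hle' := (Nat.cast_le (α := ℝ)).2 hle
  linarith

/-! ### The order of the number of iterations -/

/-- As `d ≥ 2`, `log d` is bounded below by `log 2`, so both the constant 1 and the sum of
logarithms are absorbed into a product. The case `y = 0` relies on `Real.log 0 = 0`. -/
lemma max_log_le {d : ℕ} (hd : 2 ≤ d) {y : ℝ} (hy : 0 ≤ y) :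
    max 1 (Real.log (d * y)) ≤ (Real.log 2)⁻¹ * Real.log d * (1 + Real.posLog y) := by
  have h2 : 0 < Real.log 2 := Real.log_pos one_lt_two
  have hd2 : (2 : ℝ) ≤ d := by exact_mod_cast hd
  have hlog : Real.log 2 ≤ Real.log d := Real.log_le_log two_pos hd2
  have hp : 0 ≤ Real.posLog y := Real.posLog_nonneg
  have h1 : 1 ≤ (Real.log 2)⁻¹ * Real.log d := by
    rw [inv_mul_eq_div, le_div_iff₀ h2]; linarith
  have h3 : Real.log d ≤ (Real.log 2)⁻¹ * Real.log d := by
    rw [inv_mul_eq_div, le_div_iff₀ h2]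
    nlinarith [Real.log_two_lt_d9]
  refine max_le (by nlinarith) ?_
  have h4 : Real.log (d * y) ≤ Real.log d + Real.posLog y := by
    rcases hy.eq_or_lt with rfl | hy
    · simp only [mul_zero, Real.log_zero]; linarith
    · rw [Real.log_mul (by linarith) hy.ne']
      have : Real.log y ≤ Real.posLog y := by
        rw [Real.posLog_def]; exact le_max_right _ _
      linarith
  nlinarith

lemma numIter_le {c : ℝ} (hc : 1 ≤ c) {d : ℕ} {lam ρ ε δ Δ : ℝ} (hd : 2 ≤ d) (hlam : 0 < lam)
    (hρ : 0 < ρ) (hε : 0 < ε) (hδ : 0 < δ) (hΔ : 0 ≤ Δ) :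
    numIter lam ρ ε (c * max 1 (Real.log (d * Δ / (lam * ε ^ 2 * δ)))) Δ ≤
      400 * (c * (Real.log 2)⁻¹) ^ 4 * (Δ / (lam * ε ^ 2)) * Real.log d ^ 4 *
        (1 + Real.posLog (Δ / (lam * ε ^ 2 * δ))) ^ 4 := by
  set M := max 1 (Real.log (d * Δ / (lam * ε ^ 2 * δ))) with hM
  have hM1 : 1 ≤ M := le_max_left _ _
  rw [numIter_eq_of_pos hlam hρ hε (by nlinarith) hΔ]
  have h1 : M ≤ (Real.log 2)⁻¹ * Real.log d * (1 + Real.posLog (Δ / (lam * ε ^ 2 * δ))) := by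
    rw [hM, mul_div_assoc]
    exact max_log_le hd (by positivity)
  calc 400 * (c * M) ^ 4 * (Δ / (lam * ε ^ 2))
      ≤ 400 * (c * ((Real.log 2)⁻¹ * Real.log d *
          (1 + Real.posLog (Δ / (lam * ε ^ 2 * δ))))) ^ 4 * (Δ / (lam * ε ^ 2)) := by gcongr
    _ = _ := by ring

end PerturbedProx
end

/-! ### The theorem -/

open PerturbedProx MeasureTheory ProbabilityTheory in
theorem theorem4p2 :
    ∃ c₀ : ℝ, 0 < c₀ ∧
      -- the iterates
      (∀ (d : ℕ) (f : Eu d → EReal) (ell lam ρ ε δ ι : ℝ) (x₀ : Eu d),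
        0 < d → ClosedProper f → 0 < ell → WeaklyConvex f ell →
        0 < lam → lam < ell⁻¹ / 2 →
        BddBelow (Set.range (moreau f lam)) →
        0 < ρ → 0 < ε → ε < 1 / (lam ^ 2 * ρ) → 0 < δ → δ < 1 →
        c₀ * max 1 (Real.log (d * gap (moreau f lam) x₀ / (lam * ε ^ 2 * δ))) ≤ ι →
        HessianLipschitzNearCritical (moreau f lam) ρ ε (locRadius ρ ε ι) →
        (Differentiable ℝ (moreau f lam) ∧
          ∀ x, prox f lam x = x - lam • gradient (moreau f lam) x) ∧
        ∀ (Ω : Type*) [MeasurableSpace Ω] (P : Measure Ω) [IsProbabilityMeasure P]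
          (ξ : ℕ → Ω → Eu d),
          (∀ t, Measurable (ξ t)) → iIndepFun ξ P →
          (∀ t, pdf.IsUniform (ξ t) (Metric.closedBall 0 (pertRadius ε ι)) P volume) →
          ENNReal.ofReal (1 - δ) ≤ P {ω | HalfGood f lam ρ ε ι x₀ (fun t => ξ t ω)
            ⌈numIter lam ρ ε ι (gap (moreau f lam) x₀)⌉₊}) ∧
      -- the order of the number of iterations
      (∀ c : ℝ, c₀ ≤ c → ∃ K : ℝ, ∀ (d : ℕ) (lam ρ ε δ Δ : ℝ),
        2 ≤ d → 0 < lam → 0 < ρ → 0 < ε → 0 < δ → 0 ≤ Δ →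
        numIter lam ρ ε (c * max 1 (Real.log (d * Δ / (lam * ε ^ 2 * δ)))) Δ ≤
          K * (Δ / (lam * ε ^ 2)) * Real.log d ^ 4 *
            (1 + Real.posLog (Δ / (lam * ε ^ 2 * δ))) ^ 4) := by
  -- The size of `c₀` is dictated by `iota_pow_le_exp`; the bounds `1000 ≤ ι` and `log X ≤ ι / 16`
  -- in `union_bound` need far less.
  refine ⟨10 ^ 30, by norm_num, ?_, fun c hc => ⟨400 * (c * (Real.log 2)⁻¹) ^ 4, ?_⟩⟩
  · intro d f ell lam ρ ε δ ι x₀ hd hf hell hw hlam hlam' hbdd hρ hε hε' hδ0 hδ1 hι hH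
    have hle : 2 * ell < 1 / lam := by
      rw [lt_div_iff₀ hlam]
      rw [lt_div_iff₀ two_pos] at hlam'
      have := mul_lt_mul_of_pos_left hlam' hell
      rw [mul_inv_cancel₀ hell.ne'] at this
      linarith
    have hF := isSmoothWith_moreau hf hw hlam hle hell
    have hprox := prox_eq hf hw hlam hle hell
    refine ⟨⟨hF.differentiable, hprox⟩, fun Ω _ P _ ξ hξm hind hU => ?_⟩
    have hι1 : (10 : ℝ) ^ 30 ≤ ι := by
      refine le_trans ?_ hι
      have := le_max_left 1 (Real.log (d * gap (moreau f lam) x₀ / (lam * ε ^ 2 * δ)))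
      linarith
    have hlog : (10 : ℝ) ^ 30 * Real.log (d * gap (moreau f lam) x₀ / (lam * ε ^ 2 * δ)) ≤ ι := by
      refine le_trans ?_ hι
      gcongr
      exact le_max_right _ _
    have hadm : Admissible lam ρ ε ι := ⟨hlam, hρ, hε, hε', by linarith⟩
    refine (prob_half_settled (x₀ := x₀) hd hadm hF hprox hH hbdd hδ0 hδ1 hι1 hlog rfl hξm hind
      hU).trans (measure_mono fun ω hω => ?_)
    exact halfGood_of_card_le hd hprox hadm hH hω
  · intro d lam ρ ε δ Δ hd hlam hρ hε hδ hΔ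
    exact numIter_le (le_trans (by norm_num) hc) hd hlam hρ hε hδ hΔ
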